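/- Let $\theta$ be an irrational real number and let $A_\theta$ be the noncommutative 2-torus algebra, i.e. the universal unital $C^*$-algebra generated by two unitaries $U,V$ subject to $VU=e^{2\pi i\theta}UV$. For $f\in C(\mathbb R/\mathbb Z)$ let $f(V)\in A_\theta$ be given by continuous functional calculus, with $x\mapsto e^{2\pi i x}$ corresponding to $V$. Let $\tau$ be the canonical trace, determined by $\tau\big(\sum_{m=-M}^{M}U^m a_m(V)\big)=\int_0^1 a_0(x)\,dx$. A projection $p\in A_\theta$ (that is, $p=p^*=p^2$) is said to be of order $M$ if $p=\sum_{m=-M}^{M}U^m p_m(V)$ with $p_m\in C(\mathbb R/\mathbb Z)$ and $p_M\not\equiv 0$. For $t\in\mathbb R$, $[t]\in K_0(A_\theta)$ denotes the class represented by a projection $q\in A_\theta$ with $\tau(q)=t$. Let $M$ and $n$ be integers with $1\le n\le \tfrac12 M(M+1)$, and suppose $0<\theta<1/\max(n,M)$. Then there is a projection $p\in A_\theta$ of order $M$ with $\tau(p)=n\theta$, which thus represents the class $[n\theta]$, and there is a projection $q\in A_\theta$ of order $M$ with $\tau(q)=1-n\theta$, which thus represents the class $[1-n\theta]$. -/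

import Mathlib

/-! ### `K₀` of a unital C⋆-algebra -/

section KTheory

open Matrix

/-- Murray–von Neumann equivalence of matrices over a star ring: `p = v v*` and `q = v* v`. -/
def MvN {A : Type*} [Ring A] [StarRing A] {m n : Type*} [Fintype m] [Fintype n]
    (p : Matrix m m A) (q : Matrix n n A) : Prop :=
  ∃ v : Matrix m n A, v * vᴴ = p ∧ vᴴ * v = q

/-- A projection in `M_∞(A)`: a self-adjoint idempotent square matrix of some finite size. -/
structure MatProj (A : Type*) [Ring A] [StarRing A] where
  /-- the size of the matrix -/
  size : ℕ
  /-- the matrix -/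
  mat : Matrix (Fin size) (Fin size) A
  /-- it is a self-adjoint idempotent -/
  isProj : IsStarProjection mat

theorem MvN.symm {A : Type*} [Ring A] [StarRing A] {m n : Type*} [Fintype m] [Fintype n]
    {p : Matrix m m A} {q : Matrix n n A} (h : MvN p q) : MvN q p := by
  obtain ⟨v, h1, h2⟩ := h
  exact ⟨vᴴ, by simpa using h2, by simpa using h1⟩

theorem MvN.trans {A : Type*} [Ring A] [StarRing A] {l m n : Type*}
    [Fintype l] [Fintype m] [Fintype n]
    {p : Matrix l l A} {q : Matrix m m A} {r : Matrix n n A}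
    (hp : IsIdempotentElem p) (hr : IsIdempotentElem r) (h : MvN p q) (h' : MvN q r) :
    MvN p r := by
  obtain ⟨v, h1, h2⟩ := h
  obtain ⟨w, h3, h4⟩ := h'
  refine ⟨v * w, ?_, ?_⟩
  · calc v * w * (v * w)ᴴ = v * (w * wᴴ) * vᴴ := by
          simp only [conjTranspose_mul, Matrix.mul_assoc]
      _ = (v * vᴴ) * (v * vᴴ) := by rw [h3, ← h2]; simp only [Matrix.mul_assoc]
      _ = p := by rw [h1]; exact hp
  · calc (v * w)ᴴ * (v * w) = wᴴ * (vᴴ * v) * w := by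
          simp only [conjTranspose_mul, Matrix.mul_assoc]
      _ = (wᴴ * w) * (wᴴ * w) := by rw [h2, ← h3]; simp only [Matrix.mul_assoc]
      _ = r := by rw [h4]; exact hr

theorem MvN.refl {A : Type*} [Ring A] [StarRing A] {n : Type*} [Fintype n]
    {p : Matrix n n A} (hp : IsStarProjection p) : MvN p p := by
  have hs : pᴴ = p := hp.isSelfAdjoint
  exact ⟨p, by rw [hs]; exact hp.isIdempotentElem, by rw [hs]; exact hp.isIdempotentElem⟩

/-- Relabelling the rows and columns of a projection does not change its class. -/
theorem MvN.reindex {A : Type*} [Ring A] [StarRing A] {m n : Type*} [Fintype m] [Fintype n]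
    (e : m ≃ n) {p : Matrix m m A} (hp : IsStarProjection p) :
    MvN p (p.submatrix e.symm e.symm) := by
  have hs : pᴴ = p := hp.isSelfAdjoint
  have hi : p * p = p := hp.isIdempotentElem
  refine ⟨p.submatrix id e.symm, ?_, ?_⟩
  · rw [conjTranspose_submatrix, submatrix_mul_equiv, hs, hi, submatrix_id_id]
  · rw [conjTranspose_submatrix, ← submatrix_mul _ _ _ id _ Function.bijective_id, hs, hi]

/-- The block sum of Murray–von Neumann equivalent pairs. -/
theorem MvN.fromBlocks {A : Type*} [Ring A] [StarRing A] {m n m' n' : Type*}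
    [Fintype m] [Fintype n] [Fintype m'] [Fintype n']
    {p : Matrix m m A} {q : Matrix n n A} {p' : Matrix m' m' A} {q' : Matrix n' n' A}
    (h : MvN p q) (h' : MvN p' q') :
    MvN (Matrix.fromBlocks p 0 0 p') (Matrix.fromBlocks q 0 0 q') := by
  obtain ⟨v, h1, h2⟩ := h
  obtain ⟨w, h3, h4⟩ := h'
  refine ⟨Matrix.fromBlocks v 0 0 w, ?_, ?_⟩ <;>
    simp [fromBlocks_conjTranspose, fromBlocks_multiply, *]

theorem isStarProjection_fromBlocks {A : Type*} [Ring A] [StarRing A] {m n : Type*}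
    [Fintype m] [Fintype n] {p : Matrix m m A} {q : Matrix n n A}
    (hp : IsStarProjection p) (hq : IsStarProjection q) :
    IsStarProjection (Matrix.fromBlocks p 0 0 q) := by
  have hs : pᴴ = p := hp.isSelfAdjoint
  have hi : p * p = p := hp.isIdempotentElem
  have hs' : qᴴ = q := hq.isSelfAdjoint
  have hi' : q * q = q := hq.isIdempotentElem
  refine ⟨?_, ?_⟩
  · rw [IsIdempotentElem, fromBlocks_multiply]; simp [hi, hi']
  · rw [IsSelfAdjoint, star_eq_conjTranspose, fromBlocks_conjTranspose]; simp [hs, hs']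

theorem isStarProjection_submatrix {A : Type*} [Ring A] [StarRing A] {m n : Type*}
    [Fintype m] [Fintype n] (e : n ≃ m) {p : Matrix m m A} (hp : IsStarProjection p) :
    IsStarProjection (p.submatrix e e) := by
  have hs : pᴴ = p := hp.isSelfAdjoint
  have hi : p * p = p := hp.isIdempotentElem
  refine ⟨?_, ?_⟩
  · rw [IsIdempotentElem, submatrix_mul_equiv, hi]
  · rw [IsSelfAdjoint, star_eq_conjTranspose, conjTranspose_submatrix, hs]

namespace MatProj

variable {A : Type*} [Ring A] [StarRing A]

instance setoid (A : Type*) [Ring A] [StarRing A] : Setoid (MatProj A) where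
  r p q := MvN p.mat q.mat
  iseqv :=
    { refl := fun p => MvN.refl p.isProj
      symm := fun h => h.symm
      trans := fun {p _ r} h h' =>
        MvN.trans p.isProj.isIdempotentElem r.isProj.isIdempotentElem h h' }

/-- The block-diagonal sum `p ⊕ q`. -/
def oplus (p q : MatProj A) : MatProj A where
  size := p.size + q.size
  mat := (Matrix.fromBlocks p.mat 0 0 q.mat).submatrix finSumFinEquiv.symm finSumFinEquiv.symm
  isProj := isStarProjection_submatrix _ (isStarProjection_fromBlocks p.isProj q.isProj)

theorem oplus_mvN (p q : MatProj A) :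
    MvN (p.oplus q).mat (Matrix.fromBlocks p.mat 0 0 q.mat) :=
  (MvN.reindex finSumFinEquiv (isStarProjection_fromBlocks p.isProj q.isProj)).symm

/-- The zero projection. -/
def zero (A : Type*) [Ring A] [StarRing A] : MatProj A where
  size := 0
  mat := 0
  isProj := IsStarProjection.zero _

/-- A projection of `A` as a `1 × 1` matrix. -/
def ofElem (p : A) (hp : IsStarProjection p) : MatProj A where
  size := 1
  mat := Matrix.of fun _ _ => p
  isProj := by
    refine ⟨?_, ?_⟩
    · ext i j
      simpa [Matrix.mul_apply] using hp.isIdempotentElem.eq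
    · ext i j
      simpa [star_eq_conjTranspose] using hp.isSelfAdjoint.star_eq

theorem oplus_congr {p p' q q' : MatProj A} (h : MvN p.mat p'.mat) (h' : MvN q.mat q'.mat) :
    MvN (p.oplus q).mat (p'.oplus q').mat := by
  have e1 := oplus_mvN p q
  have e2 := (oplus_mvN p' q').symm
  have e3 := MvN.fromBlocks h h'
  exact e1.trans (p.oplus q).isProj.1 (p'.oplus q').isProj.1
    (e3.trans (isStarProjection_fromBlocks p.isProj q.isProj).1 (p'.oplus q').isProj.1 e2)

theorem oplus_comm (p q : MatProj A) : MvN (p.oplus q).mat (q.oplus p).mat := by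
  have hb := isStarProjection_fromBlocks p.isProj q.isProj
  have e1 := oplus_mvN p q
  have e2 := (oplus_mvN q p).symm
  have e3 := MvN.reindex (Equiv.sumComm _ _) hb
  have e4 : (Matrix.fromBlocks p.mat 0 0 q.mat).submatrix
      (Equiv.sumComm _ _).symm (Equiv.sumComm _ _).symm = Matrix.fromBlocks q.mat 0 0 p.mat := by
    ext (i | i) (j | j) <;> rfl
  rw [e4] at e3
  exact e1.trans (p.oplus q).isProj.1 (q.oplus p).isProj.1 (e3.trans hb.1 (q.oplus p).isProj.1 e2)

theorem oplus_assoc (p q r : MatProj A) :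
    MvN ((p.oplus q).oplus r).mat (p.oplus (q.oplus r)).mat := by
  have hpq := isStarProjection_fromBlocks p.isProj q.isProj
  have hqr := isStarProjection_fromBlocks q.isProj r.isProj
  have h1 := isStarProjection_fromBlocks hpq r.isProj
  have h2 := isStarProjection_fromBlocks p.isProj hqr
  have e1 : MvN ((p.oplus q).oplus r).mat
      (Matrix.fromBlocks (Matrix.fromBlocks p.mat 0 0 q.mat) 0 0 r.mat) :=
    (oplus_mvN _ _).trans ((p.oplus q).oplus r).isProj.1 h1.1
      (MvN.fromBlocks (oplus_mvN p q) (MvN.refl r.isProj))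
  have e2 : MvN (p.oplus (q.oplus r)).mat
      (Matrix.fromBlocks p.mat 0 0 (Matrix.fromBlocks q.mat 0 0 r.mat)) :=
    (oplus_mvN _ _).trans (p.oplus (q.oplus r)).isProj.1 h2.1
      (MvN.fromBlocks (MvN.refl p.isProj) (oplus_mvN q r))
  have e3 := MvN.reindex (Equiv.sumAssoc _ _ _) h1
  have e4 : (Matrix.fromBlocks (Matrix.fromBlocks p.mat 0 0 q.mat) 0 0 r.mat).submatrix
      (Equiv.sumAssoc _ _ _).symm (Equiv.sumAssoc _ _ _).symm =
      Matrix.fromBlocks p.mat 0 0 (Matrix.fromBlocks q.mat 0 0 r.mat) := by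
    ext (i | i | i) (j | j | j) <;> rfl
  rw [e4] at e3
  exact e1.trans ((p.oplus q).oplus r).isProj.1 (p.oplus (q.oplus r)).isProj.1
    (e3.trans h1.1 (p.oplus (q.oplus r)).isProj.1 e2.symm)

theorem zero_oplus (p : MatProj A) : MvN ((zero A).oplus p).mat p.mat := by
  have hb := isStarProjection_fromBlocks (zero A).isProj p.isProj
  have e1 := oplus_mvN (zero A) p
  have : IsEmpty (Fin (zero A).size) := inferInstanceAs (IsEmpty (Fin 0))
  have e3 := MvN.reindex (Equiv.emptySum (Fin (zero A).size) (Fin p.size)) hb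
  have e4 : (Matrix.fromBlocks (zero A).mat 0 0 p.mat).submatrix
      (Equiv.emptySum (Fin (zero A).size) (Fin p.size)).symm
      (Equiv.emptySum (Fin (zero A).size) (Fin p.size)).symm = p.mat := by
    ext i j; rfl
  rw [e4] at e3
  exact e1.trans ((zero A).oplus p).isProj.1 p.isProj.1 e3

end MatProj

/-- The monoid `V(A)` of Murray–von Neumann classes of projections in `M_∞(A)`. -/
def VMonoid (A : Type*) [Ring A] [StarRing A] : Type _ := Quotient (MatProj.setoid A)

instance (A : Type*) [Ring A] [StarRing A] : Add (VMonoid A) where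
  add := Quotient.map₂ MatProj.oplus fun _ _ h _ _ h' => MatProj.oplus_congr h h'

instance (A : Type*) [Ring A] [StarRing A] : Zero (VMonoid A) where
  zero := Quotient.mk _ (MatProj.zero A)

instance (A : Type*) [Ring A] [StarRing A] : AddCommMonoid (VMonoid A) where
  add_assoc := by
    rintro ⟨p⟩ ⟨q⟩ ⟨r⟩
    exact Quotient.sound (MatProj.oplus_assoc p q r)
  add_comm := by
    rintro ⟨p⟩ ⟨q⟩
    exact Quotient.sound (MatProj.oplus_comm p q)
  zero_add := by
    rintro ⟨p⟩
    exact Quotient.sound (MatProj.zero_oplus p)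
  add_zero := by
    rintro ⟨p⟩
    exact (Quotient.sound (MatProj.oplus_comm p (MatProj.zero A))).trans
      (Quotient.sound (MatProj.zero_oplus p))
  nsmul := nsmulRec

/-- `K₀(A)` of a unital C⋆-algebra `A`: the Grothendieck group of `V(A)`. -/
abbrev K0 (A : Type*) [CStarAlgebra A] : Type _ := Algebra.GrothendieckAddGroup (VMonoid A)

/-- The class `[p] ∈ K₀(A)` of a projection `p` of `A` itself. -/
noncomputable def K0.mk {A : Type*} [CStarAlgebra A] (p : {p : A // IsStarProjection p}) : K0 A :=
  Algebra.GrothendieckAddGroup.of (Quotient.mk (MatProj.setoid A) (MatProj.ofElem p.1 p.2))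

end KTheory

/-! ### The noncommutative torus -/

noncomputable section NCTorusSection

open scoped ENNReal InnerProductSpace

/-- The number `e^{2πiθ}`. -/
def expTheta (θ : ℝ) : ℂ := Complex.exp (2 * Real.pi * Complex.I * θ)

/-- A realization of the defining relations of the noncommutative torus: two unitaries `u`, `v`
of a nonzero unital C⋆-algebra with `v u = e^{2πiθ} u v`. Carriers in `Type` lose nothing: a
C⋆-algebra generated by two elements has at most the cardinality of the continuum. -/
structure TorusRep (θ : ℝ) : Type 1 where
  /-- the C⋆-algebra -/
  carrier : Type
  [cstar : CStarAlgebra carrier]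
  [nontriv : Nontrivial carrier]
  /-- the first unitary -/
  u : unitary carrier
  /-- the second unitary -/
  v : unitary carrier
  rel : (v : carrier) * u = expTheta θ • ((u : carrier) * v)

attribute [instance] TorusRep.cstar TorusRep.nontriv

/-- The `ℓ^∞`-product of all realizations. -/
abbrev TorusProd (θ : ℝ) : Type 1 := lp (fun r : TorusRep θ => r.carrier) ∞

instance (θ : ℝ) : CStarAlgebra (TorusProd θ) where

namespace TorusProd

/-- A family of unitaries, as an element of the product. -/
def ofFamily {θ : ℝ} (w : ∀ r : TorusRep θ, unitary r.carrier) : TorusProd θ :=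
  ⟨fun r => (w r : r.carrier), by
    refine memℓp_infty ⟨1, ?_⟩
    rintro _ ⟨r, rfl⟩
    exact (CStarRing.norm_coe_unitary (w r)).le⟩

theorem ofFamily_mem_unitary {θ : ℝ} (w : ∀ r : TorusRep θ, unitary r.carrier) :
    ofFamily w ∈ unitary (TorusProd θ) := by
  constructor
  · apply lp.ext
    funext r
    exact (Unitary.mem_iff.1 (w r).2).1
  · apply lp.ext
    funext r
    exact (Unitary.mem_iff.1 (w r).2).2

/-- Evaluation of the product at one realization. -/
def eval {θ : ℝ} (r : TorusRep θ) : TorusProd θ →⋆ₐ[ℂ] r.carrier where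
  toFun a := a r
  map_one' := rfl
  map_mul' _ _ := rfl
  map_zero' := rfl
  map_add' _ _ := rfl
  commutes' _ := rfl
  map_star' _ := rfl

end TorusProd

/-- The closed star subalgebra of the product generated by the family `U` of all `u`'s and the
family `V` of all `v`'s. -/
def torusSubalgebra (θ : ℝ) : StarSubalgebra ℂ (TorusProd θ) :=
  (StarAlgebra.adjoin ℂ {TorusProd.ofFamily (θ := θ) fun r => r.u,
    TorusProd.ofFamily (θ := θ) fun r => r.v}).topologicalClosure

/-- The algebra `A_θ` of the noncommutative 2-torus: the universal unital C⋆-algebra generated by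
two unitaries `U`, `V` with `V U = e^{2πiθ} U V`. -/
def NCTorus (θ : ℝ) : Type 1 := torusSubalgebra θ

/-- The C⋆-algebra structure of `A_θ`. -/
def NCTorus.cstar (θ : ℝ) : CStarAlgebra (NCTorus θ) :=
  StarSubalgebra.cstarAlgebra (torusSubalgebra θ)
    (h_closed := StarSubalgebra.isClosed_topologicalClosure _)

instance (θ : ℝ) : CStarAlgebra (NCTorus θ) := NCTorus.cstar θ

namespace NCTorus

/-- The inclusion of `A_θ` into the product. -/
def incl (θ : ℝ) : NCTorus θ →⋆ₐ[ℂ] TorusProd θ where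
  toFun a := a.1
  map_one' := rfl
  map_mul' _ _ := rfl
  map_zero' := rfl
  map_add' _ _ := rfl
  commutes' _ := rfl
  map_star' _ := rfl

theorem incl_injective (θ : ℝ) : Function.Injective (incl θ) := Subtype.val_injective

/-- The first generating unitary. -/
def U (θ : ℝ) : unitary (NCTorus θ) :=
  ⟨⟨TorusProd.ofFamily (θ := θ) fun r => r.u, StarSubalgebra.le_topologicalClosure _
    (StarAlgebra.subset_adjoin ℂ _ (by simp))⟩, by
    have h := TorusProd.ofFamily_mem_unitary (θ := θ) fun r => r.u
    exact ⟨incl_injective θ h.1, incl_injective θ h.2⟩⟩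

/-- The second generating unitary. -/
def V (θ : ℝ) : unitary (NCTorus θ) :=
  ⟨⟨TorusProd.ofFamily (θ := θ) fun r => r.v, StarSubalgebra.le_topologicalClosure _
    (StarAlgebra.subset_adjoin ℂ _ (by simp))⟩, by
    have h := TorusProd.ofFamily_mem_unitary (θ := θ) fun r => r.v
    exact ⟨incl_injective θ h.1, incl_injective θ h.2⟩⟩

/-- The commutation relation `V U = e^{2πiθ} U V`. -/
theorem V_mul_U (θ : ℝ) :
    (V θ : NCTorus θ) * (U θ : NCTorus θ) = expTheta θ • ((U θ : NCTorus θ) * (V θ : NCTorus θ)) := by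
  apply incl_injective θ
  apply lp.ext
  funext r
  exact r.rel

/-- The star homomorphism from `A_θ` onto the C⋆-algebra generated by a realization. -/
def toRep {θ : ℝ} (r : TorusRep θ) : NCTorus θ →⋆ₐ[ℂ] r.carrier :=
  (TorusProd.eval r).comp (incl θ)

theorem toRep_U {θ : ℝ} (r : TorusRep θ) : toRep r (U θ : NCTorus θ) = r.u := rfl

theorem toRep_V {θ : ℝ} (r : TorusRep θ) : toRep r (V θ : NCTorus θ) = r.v := rfl

/-- `A_θ` is generated by `U` and `V`. -/
theorem topologicalClosure_adjoin_eq_top (θ : ℝ) :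
    (StarAlgebra.adjoin ℂ {(U θ : NCTorus θ), (V θ : NCTorus θ)}).topologicalClosure = ⊤ := by
  rw [eq_top_iff]
  intro a _
  have hind : Topology.IsInducing (incl θ) := Topology.IsInducing.subtypeVal
  change a ∈ closure _
  rw [hind.closure_eq_preimage_closure_image]
  have himg : (incl θ) '' (StarAlgebra.adjoin ℂ {(U θ : NCTorus θ), (V θ : NCTorus θ)} : Set (NCTorus θ)) =
      (StarAlgebra.adjoin ℂ {TorusProd.ofFamily (θ := θ) fun r => r.u,
    TorusProd.ofFamily (θ := θ) fun r => r.v} : Set (TorusProd θ)) := by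
    have := StarAlgHom.map_adjoin (incl θ) {(U θ : NCTorus θ), (V θ : NCTorus θ)}
    rw [Set.image_pair] at this
    exact congrArg SetLike.coe this
  rw [himg]
  exact a.2

/-- The universal property of `A_θ`. -/
theorem existsUnique_hom {θ : ℝ} {B : Type} [CStarAlgebra B] (u v : unitary B)
    (h : (v : B) * u = expTheta θ • ((u : B) * v)) :
    ∃! φ : NCTorus θ →⋆ₐ[ℂ] B, φ (U θ : NCTorus θ) = u ∧ φ (V θ : NCTorus θ) = v := by
  refine existsUnique_of_exists_of_unique ?_ ?_
  · rcases subsingleton_or_nontrivial B with hB | hB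
    · exact ⟨{ toFun := fun _ => 0
               map_one' := Subsingleton.elim _ _
               map_mul' := fun _ _ => Subsingleton.elim _ _
               map_zero' := rfl
               map_add' := fun _ _ => Subsingleton.elim _ _
               commutes' := fun _ => Subsingleton.elim _ _
               map_star' := fun _ => Subsingleton.elim _ _ },
        Subsingleton.elim _ _, Subsingleton.elim _ _⟩
    · exact ⟨toRep ⟨B, u, v, h⟩, rfl, rfl⟩
  · have hc : ∀ χ : NCTorus θ →⋆ₐ[ℂ] B, Continuous χ := fun χ =>
      AddMonoidHomClass.continuous_of_bound χ 1 fun a => by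
        simpa using NonUnitalStarAlgHom.norm_apply_le χ a
    rintro φ ψ ⟨h1, h2⟩ ⟨h3, h4⟩
    have hle : StarAlgebra.adjoin ℂ {(U θ : NCTorus θ), (V θ : NCTorus θ)} ≤
        StarAlgHom.equalizer φ ψ := by
      refine StarAlgebra.adjoin_le ?_
      rintro x (rfl | rfl)
      · exact h1.trans h3.symm
      · exact h2.trans h4.symm
    have hcl : IsClosed (StarAlgHom.equalizer φ ψ : Set (NCTorus θ)) := isClosed_eq (hc φ) (hc ψ)
    have := StarSubalgebra.topologicalClosure_minimal hle hcl
    rw [topologicalClosure_adjoin_eq_top] at this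
    ext a
    exact this trivial

end NCTorus

/-! ### The canonical trace -/

/-- The Hilbert space `ℓ²(ℤ²)`. -/
abbrev L2Z2 : Type := lp (fun _ : ℤ × ℤ => ℂ) 2

/-- The unitary operator `(W f)(i) = c(i) f(σ i)` on `ℓ²(ℤ²)`. -/
def weightedShift (c : ℤ × ℤ → Circle) (σ : ℤ × ℤ ≃ ℤ × ℤ) : L2Z2 ≃ₗᵢ[ℂ] L2Z2 :=
  have key : ∀ (c : ℤ × ℤ → Circle) (σ : ℤ × ℤ ≃ ℤ × ℤ) (f : L2Z2),
      Memℓp (fun i => (c i : ℂ) * f (σ i)) 2 := fun c σ f => by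
    have h := lp.memℓp f
    rw [memℓp_gen_iff (by norm_num)] at h ⊢
    have h2 := (σ.summable_iff).2 h
    refine h2.congr fun i => ?_
    rw [norm_mul, Circle.norm_coe, one_mul]
    rfl
  { toFun := fun f => ⟨fun i => (c i : ℂ) * f (σ i), key c σ f⟩
    invFun := fun f => ⟨fun i => ((c (σ.symm i))⁻¹ : Circle) * f (σ.symm i),
      key (fun i => (c (σ.symm i))⁻¹) σ.symm f⟩
    map_add' := fun f g => by
      apply lp.ext; funext i
      change (c i : ℂ) * (f (σ i) + g (σ i)) = c i * f (σ i) + c i * g (σ i)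
      ring
    map_smul' := fun a f => by
      apply lp.ext; funext i
      change (c i : ℂ) * (a * f (σ i)) = a * (c i * f (σ i))
      ring
    left_inv := fun f => by
      apply lp.ext; funext i
      simp
    right_inv := fun f => by
      apply lp.ext; funext i
      simp
    norm_map' := fun f => by
      rw [lp.norm_eq_tsum_rpow (by norm_num), lp.norm_eq_tsum_rpow (by norm_num)]
      congr 1
      refine (tsum_congr fun i => ?_).trans
        (σ.tsum_eq fun i => ‖f i‖ ^ ENNReal.toReal 2)
      change ‖(c i : ℂ) * f (σ i)‖ ^ ENNReal.toReal 2 = _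
      rw [norm_mul, Circle.norm_coe, one_mul] }

theorem weightedShift_apply (c : ℤ × ℤ → Circle) (σ : ℤ × ℤ ≃ ℤ × ℤ) (f : L2Z2) (i : ℤ × ℤ) :
    weightedShift c σ f i = c i * f (σ i) := rfl

/-- `(u f)(m, k) = f(m - 1, k)`. -/
def regU : L2Z2 ≃ₗᵢ[ℂ] L2Z2 :=
  weightedShift (fun _ => 1) ((Equiv.subRight 1).prodCongr (Equiv.refl ℤ))

/-- `(v f)(m, k) = e^{2πiθm} f(m, k - 1)`. -/
def regV (θ : ℝ) : L2Z2 ≃ₗᵢ[ℂ] L2Z2 :=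
  weightedShift (fun i => Circle.exp (2 * Real.pi * θ) ^ i.1)
    ((Equiv.refl ℤ).prodCongr (Equiv.subRight 1))

instance : Nontrivial L2Z2 :=
  ⟨⟨lp.single 2 (0, 0) 1, 0, fun h => by
    have := congrArg (fun f : L2Z2 => f (0, 0)) h
    simp at this⟩⟩

/-- The regular representation of `A_θ` on `ℓ²(ℤ²)`. -/
def regularRep (θ : ℝ) : TorusRep θ where
  carrier := L2Z2 →L[ℂ] L2Z2
  u := Unitary.linearIsometryEquiv.symm regU
  v := Unitary.linearIsometryEquiv.symm (regV θ)
  rel := by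
    ext f i
    obtain ⟨m, k⟩ := i
    change ((Circle.exp (2 * Real.pi * θ) ^ m : Circle) : ℂ) * (((1 : Circle) : ℂ) * f (m - 1, k - 1)) =
      expTheta θ * (((1 : Circle) : ℂ) *
        (((Circle.exp (2 * Real.pi * θ) ^ (m - 1) : Circle) : ℂ) * f (m - 1, k - 1)))
    have h : expTheta θ = (Circle.exp (2 * Real.pi * θ) : ℂ) := by
      rw [expTheta, Circle.coe_exp]; push_cast; ring_nf
    rw [h, zpow_sub_one]
    push_cast
    have h0 : (Circle.exp (2 * Real.pi * θ) : ℂ) ≠ 0 := Circle.coe_ne_zero _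
    field_simp

namespace NCTorus

/-- The regular representation as a star homomorphism. -/
def regularHom (θ : ℝ) : NCTorus θ →⋆ₐ[ℂ] (L2Z2 →L[ℂ] L2Z2) := toRep (regularRep θ)

/-- The unit vector at the origin of `ℤ²`. -/
def vac : L2Z2 := lp.single 2 ((0, 0) : ℤ × ℤ) (1 : ℂ)

/-- The canonical trace `τ` of `A_θ`, as the vacuum state of the regular representation. It is the
continuous extension of `τ(∑ U^m a_m(V)) = ∫₀¹ a₀(x) dx`, see `trace_fourierSum` below. -/
def trace {θ : ℝ} (a : NCTorus θ) : ℂ := ⟪vac, regularHom θ a vac⟫_ℂ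

end NCTorus

/-! ### Continuous functions of a unitary -/

/-- The point `x ∈ ℝ/ℤ` with `z = e^{2πix}`, for `z` in the spectrum of a unitary. -/
def spectrumToCircle {B : Type*} [CStarAlgebra B] (v : unitary B) :
    C(spectrum ℂ (v : B), UnitAddCircle) where
  toFun z := (AddCircle.homeomorphCircle (T := (1 : ℝ)) one_ne_zero).symm
    ⟨z, Unitary.spectrum_subset_circle v z.2⟩
  continuous_toFun := (AddCircle.homeomorphCircle _).symm.continuous.comp
    (Continuous.subtype_mk continuous_subtype_val _)

/-- The functional calculus `f ↦ f(v)` of a unitary `v`, for continuous functions `f` on `ℝ/ℤ`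
(so that `x ↦ e^{2πix}` goes to `v`). -/
def unitaryCalc {B : Type*} [CStarAlgebra B] (v : unitary B) : C(UnitAddCircle, ℂ) →⋆ₐ[ℂ] B :=
  (cfcHom (R := ℂ) (a := (v : B)) (p := IsStarNormal) inferInstance).comp
    ((spectrumToCircle v).compStarAlgHom' ℂ ℂ)

theorem unitaryCalc_fourier_one {B : Type*} [CStarAlgebra B] (v : unitary B) :
    unitaryCalc v (fourier 1) = v := by
  have h : (spectrumToCircle v).compStarAlgHom' ℂ ℂ (fourier 1) =
      (ContinuousMap.id ℂ).restrict (spectrum ℂ (v : B)) := by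
    ext z
    change fourier 1 (spectrumToCircle v z) = (z : ℂ)
    rw [fourier_one, ← AddCircle.homeomorphCircle_apply one_ne_zero]
    exact congrArg Subtype.val ((AddCircle.homeomorphCircle one_ne_zero).apply_symm_apply _)
  rw [unitaryCalc, StarAlgHom.comp_apply, h, cfcHom_id]

theorem unitaryCalc_fourier {B : Type*} [CStarAlgebra B] (v : unitary B) (k : ℤ) :
    unitaryCalc v (fourier k) = ((v ^ k : unitary B) : B) := by
  induction k using Int.induction_on with
  | zero =>
    have : (fourier 0 : C(UnitAddCircle, ℂ)) = 1 := by ext x; simp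
    rw [this, map_one]; simp
  | succ k ih =>
    have : (fourier ((k : ℤ) + 1) : C(UnitAddCircle, ℂ)) = fourier (k : ℤ) * fourier 1 := by
      ext x; exact fourier_add
    rw [this, map_mul, ih, unitaryCalc_fourier_one, zpow_add_one]; rfl
  | pred k ih =>
    have : (fourier (-(k : ℤ) - 1) : C(UnitAddCircle, ℂ)) = fourier (-(k : ℤ)) * star (fourier 1) := by
      ext x
      rw [sub_eq_add_neg]
      exact fourier_add.trans (congrArg _ fourier_neg)
    rw [this, map_mul, map_star, ih, unitaryCalc_fourier_one, zpow_sub_one]; rfl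

theorem continuous_unitaryCalc {B : Type*} [CStarAlgebra B] (v : unitary B) :
    Continuous (unitaryCalc v) :=
  AddMonoidHomClass.continuous_of_bound (unitaryCalc v) 1 fun a => by
    simpa using NonUnitalStarAlgHom.norm_apply_le (unitaryCalc v) a

theorem L2Z2.mul_apply (a b : L2Z2 ≃ₗᵢ[ℂ] L2Z2) (f : L2Z2) : (a * b) f = a (b f) := rfl

theorem regU_zpow (m : ℤ) (f : L2Z2) (i : ℤ × ℤ) : (regU ^ m) f i = f (i.1 - m, i.2) := by
  induction m using Int.induction_on generalizing i with
  | zero => simp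
  | succ m ih =>
    rw [add_comm, zpow_add, zpow_one, L2Z2.mul_apply, regU, weightedShift_apply]
    rw [← regU, ih]
    simp [sub_sub]
  | pred m ih =>
    have h : ∀ (g : L2Z2) (i : ℤ × ℤ), (regU⁻¹ g) i = g (i.1 + 1, i.2) := fun g i => by
      have : regU (regU⁻¹ g) (i.1 + 1, i.2) = g (i.1 + 1, i.2) :=
        congrArg (fun x : L2Z2 => x (i.1 + 1, i.2)) (LinearIsometryEquiv.apply_symm_apply regU g)
      rw [← this]
      nth_rw 2 [regU]
      rw [weightedShift_apply]
      simp
    rw [sub_eq_add_neg, add_comm, zpow_add, zpow_neg_one, L2Z2.mul_apply, h, ih]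
    have e : i.1 + 1 - -(m : ℤ) = i.1 - (-1 + -(m : ℤ)) := by ring
    rw [e]

theorem regV_zpow (θ : ℝ) (k : ℤ) (f : L2Z2) (m j : ℤ) :
    (regV θ ^ k) f (m, j) =
      (((Circle.exp (2 * Real.pi * θ) ^ m) ^ k : Circle) : ℂ) * f (m, j - k) := by
  induction k using Int.induction_on generalizing j with
  | zero => simp
  | succ l ih =>
    have h : ∀ (g : L2Z2) (j : ℤ), (regV θ g) (m, j) =
        ((Circle.exp (2 * Real.pi * θ) ^ m : Circle) : ℂ) * g (m, j - 1) := fun g j => rfl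
    rw [add_comm, zpow_add, zpow_one, L2Z2.mul_apply, h, ih, zpow_add, zpow_one, Circle.coe_mul,
      sub_sub]
    exact (mul_assoc _ _ _).symm
  | pred l ih =>
    have h : ∀ (g : L2Z2) (j : ℤ), ((regV θ)⁻¹ g) (m, j) =
        (((Circle.exp (2 * Real.pi * θ) ^ m)⁻¹ : Circle) : ℂ) * g (m, j + 1) := fun g j => by
      have h1 : regV θ ((regV θ)⁻¹ g) (m, j + 1) = g (m, j + 1) :=
        congrArg (fun x : L2Z2 => x (m, j + 1)) (LinearIsometryEquiv.apply_symm_apply (regV θ) g)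
      have h2 : ∀ (g : L2Z2) (j : ℤ), (regV θ g) (m, j) =
        ((Circle.exp (2 * Real.pi * θ) ^ m : Circle) : ℂ) * g (m, j - 1) := fun g j => rfl
      rw [h2, add_sub_cancel_right] at h1
      rw [← h1, ← mul_assoc, ← Circle.coe_mul, inv_mul_cancel, Circle.coe_one, one_mul]
    rw [sub_eq_add_neg, add_comm, zpow_add, zpow_neg_one, L2Z2.mul_apply, h, ih, zpow_add,
      zpow_neg_one, Circle.coe_mul]
    have e : j + 1 - -(l : ℤ) = j - (-1 + -(l : ℤ)) := by ring
    rw [e]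
    exact (mul_assoc _ _ _).symm

namespace NCTorus

/-- `∑_{m=-M}^{M} U^m a_m(V)`. -/
def fourierSum (θ : ℝ) (M : ℕ) (a : ℤ → C(UnitAddCircle, ℂ)) : NCTorus θ :=
  ∑ m ∈ Finset.Icc (-(M : ℤ)) M, ((U θ ^ m : unitary (NCTorus θ)) : NCTorus θ) *
    unitaryCalc (V θ) (a m)

theorem regularHom_U_zpow (θ : ℝ) (m : ℤ) (f : L2Z2) :
    regularHom θ ((U θ ^ m : unitary (NCTorus θ)) : NCTorus θ) f = (regU ^ m) f := by
  have h : Unitary.map (StarMonoidHom.ofClass (regularHom θ)) (U θ) = Unitary.linearIsometryEquiv.symm regU := rfl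
  have h2 : Unitary.map (StarMonoidHom.ofClass (regularHom θ)) (U θ ^ m) =
      Unitary.linearIsometryEquiv.symm (regU ^ m) := by
    rw [map_zpow, h, map_zpow]
  exact congrArg (fun w : unitary (L2Z2 →L[ℂ] L2Z2) => (w : L2Z2 →L[ℂ] L2Z2) f) h2

theorem regularHom_V_zpow (θ : ℝ) (m : ℤ) (f : L2Z2) :
    regularHom θ ((V θ ^ m : unitary (NCTorus θ)) : NCTorus θ) f = (regV θ ^ m) f := by
  have h : Unitary.map (StarMonoidHom.ofClass (regularHom θ)) (V θ) = Unitary.linearIsometryEquiv.symm (regV θ) := rfl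
  have h2 : Unitary.map (StarMonoidHom.ofClass (regularHom θ)) (V θ ^ m) =
      Unitary.linearIsometryEquiv.symm (regV θ ^ m) := by
    rw [map_zpow, h, map_zpow]
  exact congrArg (fun w : unitary (L2Z2 →L[ℂ] L2Z2) => (w : L2Z2 →L[ℂ] L2Z2) f) h2

theorem trace_eq {θ : ℝ} (a : NCTorus θ) : trace a = (regularHom θ a vac) (0, 0) := by
  simp [trace, vac, lp.inner_single_left]

theorem continuous_trace (θ : ℝ) : Continuous (trace : NCTorus θ → ℂ) := by
  have h : Continuous (regularHom θ) :=
    AddMonoidHomClass.continuous_of_bound (regularHom θ) 1 fun a => by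
      simpa using NonUnitalStarAlgHom.norm_apply_le (regularHom θ) a
  unfold trace
  fun_prop

theorem trace_add {θ : ℝ} (a b : NCTorus θ) : trace (a + b) = trace a + trace b := by
  simp [trace_eq]

theorem trace_smul {θ : ℝ} (c : ℂ) (a : NCTorus θ) : trace (c • a) = c * trace a := by
  simp [trace_eq]

theorem trace_U_zpow_mul_V_zpow (θ : ℝ) (m k : ℤ) :
    trace (((U θ ^ m : unitary (NCTorus θ)) : NCTorus θ) * ((V θ ^ k : unitary (NCTorus θ)) : NCTorus θ)) =
      if m = 0 ∧ k = 0 then 1 else 0 := by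
  rw [trace_eq, map_mul, mul_apply_eq_comp, regularHom_U_zpow, regularHom_V_zpow,
    regU_zpow, regV_zpow]
  by_cases hm : m = 0
  · subst hm
    by_cases hk : k = 0
    · subst hk
      simp [vac]
    · have : vac ((0 : ℤ) - 0, (0 : ℤ) - k) = 0 :=
        lp.single_apply_ne 2 _ _ fun h => hk (by simpa using congrArg Prod.snd h)
      rw [this]
      simp [hk]
  · have : vac ((0 : ℤ) - m, (0 : ℤ) - k) = 0 :=
      lp.single_apply_ne 2 _ _ fun h => hm (by simpa using congrArg Prod.fst h)
    rw [this]
    simp [hm]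

theorem integral_fourier_eq (k : ℤ) :
    ∫ x in (0 : ℝ)..1, fourier k (x : UnitAddCircle) = if k = 0 then 1 else 0 := by
  have h := fourierCoeff_eq_intervalIntegral (T := (1 : ℝ)) (fourier k : UnitAddCircle → ℂ) 0 0
  simp only [neg_zero, fourier_zero, one_smul, zero_add, div_one] at h
  rw [← h, fourierCoeff_fourier]
  by_cases hk : k = 0
  · subst hk; simp
  · rw [if_neg hk]
    exact Pi.single_eq_of_ne (Ne.symm hk) _

/-- `τ(U^m f(V))` is `∫₀¹ f(x) dx` for `m = 0`, and `0` otherwise. -/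
theorem trace_U_zpow_mul (θ : ℝ) (m : ℤ) (f : C(UnitAddCircle, ℂ)) :
    trace (((U θ ^ m : unitary (NCTorus θ)) : NCTorus θ) * unitaryCalc (V θ) f) =
      if m = 0 then ∫ x in (0 : ℝ)..1, f (x : UnitAddCircle) else 0 := by
  have hint : ∀ g : C(UnitAddCircle, ℂ),
      IntervalIntegrable (fun x : ℝ => g (x : UnitAddCircle)) MeasureTheory.volume 0 1 := fun g =>
    (g.continuous.comp (AddCircle.continuous_mk' 1)).intervalIntegrable 0 1
  let L1 : C(UnitAddCircle, ℂ) →L[ℂ] ℂ :=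
    { toFun := fun f =>
        trace (((U θ ^ m : unitary (NCTorus θ)) : NCTorus θ) * unitaryCalc (V θ) f)
      map_add' := fun f g => by rw [map_add, mul_add, trace_add]
      map_smul' := fun c f => by rw [map_smul, mul_smul_comm, trace_smul]; rfl
      cont := (continuous_trace θ).comp (continuous_const.mul (continuous_unitaryCalc _)) }
  let L2 : C(UnitAddCircle, ℂ) →L[ℂ] ℂ := LinearMap.mkContinuous
    { toFun := fun f => if m = 0 then ∫ x in (0 : ℝ)..1, f (x : UnitAddCircle) else 0
      map_add' := fun f g => by
        split_ifs
        · exact intervalIntegral.integral_add (hint f) (hint g)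
        · simp
      map_smul' := fun c f => by
        split_ifs
        · exact intervalIntegral.integral_smul c _
        · simp } 1 (fun f => by
        change ‖if m = 0 then ∫ x in (0 : ℝ)..1, f (x : UnitAddCircle) else 0‖ ≤ _
        split_ifs
        · have := intervalIntegral.norm_integral_le_of_norm_le_const (a := (0 : ℝ)) (b := 1)
            (f := fun x : ℝ => f (x : UnitAddCircle)) (C := ‖f‖) fun x _ => f.norm_coe_le_norm _
          simpa using this
        · simp)
  have h : L1 = L2 := by
    refine ContinuousLinearMap.ext_on (s := Set.range (fourier (T := (1 : ℝ)))) ?_ ?_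
    · have := span_fourier_closure_eq_top (T := (1 : ℝ))
      exact Submodule.dense_iff_topologicalClosure_eq_top.2 this
    · rintro _ ⟨k, rfl⟩
      change trace (((U θ ^ m : unitary (NCTorus θ)) : NCTorus θ) *
        unitaryCalc (V θ) (fourier k)) =
        if m = 0 then ∫ x in (0 : ℝ)..1, fourier k (x : UnitAddCircle) else 0
      rw [unitaryCalc_fourier, trace_U_zpow_mul_V_zpow, integral_fourier_eq]
      by_cases hm : m = 0 <;> simp [hm]
  exact congrArg (fun L : C(UnitAddCircle, ℂ) →L[ℂ] ℂ => L f) h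

/-- The formula `τ(∑ U^m a_m(V)) = ∫₀¹ a₀(x) dx`. -/
theorem trace_fourierSum (θ : ℝ) (M : ℕ) (a : ℤ → C(UnitAddCircle, ℂ)) :
    trace (fourierSum θ M a) = ∫ x in (0 : ℝ)..1, a 0 (x : UnitAddCircle) := by
  have h0 : ∀ s : Finset ℤ, trace (∑ m ∈ s, ((U θ ^ m : unitary (NCTorus θ)) : NCTorus θ) *
      unitaryCalc (V θ) (a m)) = ∑ m ∈ s, trace (((U θ ^ m : unitary (NCTorus θ)) : NCTorus θ) *
      unitaryCalc (V θ) (a m)) := fun s => by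
    induction s using Finset.induction_on with
    | empty => simp [trace_eq]
    | insert i s hi ih => rw [Finset.sum_insert hi, Finset.sum_insert hi, trace_add, ih]
  rw [fourierSum, h0]
  simp [trace_U_zpow_mul]

/-! ### Order of a projection and classes in `K₀` -/

/-- `p` is of order `M`: it is of the form `p = ∑_{m=-M}^{M} U^m p_m(V)` with continuous
functions `p_m` on `ℝ/ℤ`, and `p_M` is not identically zero. -/
def HasOrder {θ : ℝ} (p : NCTorus θ) (M : ℕ) : Prop :=
  ∃ a : ℤ → C(UnitAddCircle, ℂ), p = fourierSum θ M a ∧ a M ≠ 0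

/-- `c = [t]` in `K₀(A_θ)`, where `[t]` denotes the class represented by a projection `q` of `A_θ`
with `τ(q) = t`. -/
def IsClassOfTrace {θ : ℝ} (c : K0 (NCTorus θ)) (t : ℝ) : Prop :=
  ∃ q : {q : NCTorus θ // IsStarProjection q}, trace q.1 = (t : ℂ) ∧ c = K0.mk q

end NCTorus

end NCTorusSection

/-!
The projection is a Powers–Rieffel projection with one more off-diagonal term:
`p = f(V) + (U g(V) + h.c.) + (U^M h(V) + h.c.)` with real continuous `f`, `g`, `h`. By the
covariance relation `a(V) U^k = U^k a(· + kθ)(V)` (`NCTorus.unitaryCalc_mul_U_zpow`), `p` acts on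
each orbit of the rotation by `θ` as a matrix. If no point takes part in more than one
off-diagonal entry, this matrix is a direct sum of blocks of size one and two, and `p` is a
projection as soon as each block is one (`isStarProjection_add_add_star`,
`NCTorus.isStarProjection_twoStep`).

To get the trace `nθ`, let `f` be the sum of `n` disjoint trapezoids of area `θ`, and let `g` be
`√(f(1 - f))` on the rising slopes: the slope at `x` and the falling slope at `x + θ` form the block
with diagonal `f(x)`, `1 - f(x)`. To get the order `M`, choose a small interval `I` in a plateau
`f = 1` such that `I + Mθ` lies in the region `f = 0`, which is possible since
`max(n, M) θ < 1`, and replace the block `diag(1, 0)` over `I` and `I + Mθ` by the projection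
with diagonal `1 - m`, `m` and off-diagonal entry `h = √(m(1 - m))`, for a bump function `m` on `I`.
This does not change the integral of `f`, and `h` is not zero
(`ProjectionProfile.exists_isProfile`). The projection of trace `1 - nθ` is `1 - p`, which
has the same order because `M ≥ 1`.
-/

/-! ### The covariance relation and the multiplication of monomials -/

namespace NCTorus

/-- The rotation `(α_k a)(x) = a(x + kθ)` of a continuous function on `ℝ/ℤ`. -/
noncomputable def rotate (θ : ℝ) (k : ℤ) (a : C(UnitAddCircle, ℂ)) : C(UnitAddCircle, ℂ) :=
  a.comp ⟨fun x => x + ((k * θ : ℝ) : UnitAddCircle), by fun_prop⟩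

theorem rotate_apply (θ : ℝ) (k : ℤ) (a : C(UnitAddCircle, ℂ)) (x : UnitAddCircle) :
    rotate θ k a x = a (x + ((k * θ : ℝ) : UnitAddCircle)) := rfl

theorem rotate_rotate (θ : ℝ) (j k : ℤ) (a : C(UnitAddCircle, ℂ)) :
    rotate θ j (rotate θ k a) = rotate θ (j + k) a := by
  ext x
  simp only [rotate_apply]
  congr 1
  push_cast
  rw [add_mul, AddCircle.coe_add, add_assoc]

theorem rotate_zero (θ : ℝ) (a : C(UnitAddCircle, ℂ)) : rotate θ 0 a = a := by
  ext x
  simp [rotate_apply]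

theorem rotate_star (θ : ℝ) (k : ℤ) (a : C(UnitAddCircle, ℂ)) :
    rotate θ k (star a) = star (rotate θ k a) := rfl

theorem rotate_mul (θ : ℝ) (k : ℤ) (a b : C(UnitAddCircle, ℂ)) :
    rotate θ k (a * b) = rotate θ k a * rotate θ k b := rfl

theorem unitaryCalc_mul_U_fourier (θ : ℝ) (k : ℤ) :
    unitaryCalc (V θ) (fourier k) * (U θ : NCTorus θ) =
      (U θ : NCTorus θ) * unitaryCalc (V θ) (rotate θ 1 (fourier k)) := by
  have hmul : ∀ a b : C(UnitAddCircle, ℂ),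
      unitaryCalc (V θ) a * (U θ : NCTorus θ) =
        (U θ : NCTorus θ) * unitaryCalc (V θ) (rotate θ 1 a) →
      unitaryCalc (V θ) b * (U θ : NCTorus θ) =
        (U θ : NCTorus θ) * unitaryCalc (V θ) (rotate θ 1 b) →
      unitaryCalc (V θ) (a * b) * (U θ : NCTorus θ) =
        (U θ : NCTorus θ) * unitaryCalc (V θ) (rotate θ 1 (a * b)) := fun a b ha hb => by
    rw [map_mul, mul_assoc, hb, ← mul_assoc, ha, mul_assoc, ← map_mul, rotate_mul]
  have hstar : ∀ a : C(UnitAddCircle, ℂ),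
      unitaryCalc (V θ) a * (U θ : NCTorus θ) =
        (U θ : NCTorus θ) * unitaryCalc (V θ) (rotate θ 1 a) →
      unitaryCalc (V θ) (star a) * (U θ : NCTorus θ) =
        (U θ : NCTorus θ) * unitaryCalc (V θ) (rotate θ 1 (star a)) := fun a ha => by
    have h := congrArg star ha
    rw [star_mul, star_mul, ← map_star, ← map_star, ← rotate_star] at h
    have h' := congrArg (fun z : NCTorus θ => (U θ : NCTorus θ) * z * (U θ : NCTorus θ)) h
    simp only [mul_assoc, Unitary.coe_star_mul_self, mul_one] at h'
    have hU : (U θ : NCTorus θ) * star (U θ : NCTorus θ) = 1 := (U θ).2.2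
    rw [← mul_assoc, hU, one_mul] at h'
    exact h'
  have hone : unitaryCalc (V θ) (fourier 1) * (U θ : NCTorus θ) =
      (U θ : NCTorus θ) * unitaryCalc (V θ) (rotate θ 1 (fourier 1)) := by
    have e : rotate θ 1 (fourier 1) = expTheta θ • (fourier 1 : C(UnitAddCircle, ℂ)) := by
      ext x
      have h1 : (fourier 1 (((1 : ℤ) * θ : ℝ) : UnitAddCircle) : ℂ) = expTheta θ := by
        rw [fourier_coe_apply, expTheta]
        push_cast
        ring_nf
      have h2 : (fourier 1 (x + (((1 : ℤ) * θ : ℝ) : UnitAddCircle)) : ℂ) =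
          fourier 1 x * fourier 1 (((1 : ℤ) * θ : ℝ) : UnitAddCircle) := by
        simp [fourier_apply, AddCircle.toCircle_add]
      rw [rotate_apply, h2, h1, ContinuousMap.smul_apply, smul_eq_mul, mul_comm]
    rw [e, map_smul, unitaryCalc_fourier_one, V_mul_U, mul_smul_comm]
  induction k using Int.induction_on with
  | zero =>
    have h0 : (fourier 0 : C(UnitAddCircle, ℂ)) = 1 := by ext x; simp
    have h1 : rotate θ 1 (1 : C(UnitAddCircle, ℂ)) = 1 := rfl
    rw [h0, h1, map_one, one_mul, mul_one]
  | succ k ih =>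
    have : (fourier ((k : ℤ) + 1) : C(UnitAddCircle, ℂ)) = fourier (k : ℤ) * fourier 1 := by
      ext x; exact fourier_add
    rw [this]
    exact hmul _ _ ih hone
  | pred k ih =>
    have : (fourier (-(k : ℤ) - 1) : C(UnitAddCircle, ℂ)) =
        fourier (-(k : ℤ)) * star (fourier 1) := by
      ext x
      rw [sub_eq_add_neg]
      exact fourier_add.trans (congrArg _ fourier_neg)
    rw [this]
    exact hmul _ _ ih (hstar _ hone)

theorem continuous_rotate (θ : ℝ) (k : ℤ) : Continuous (rotate θ k) :=
  ContinuousMap.continuous_precomp _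

/-- The covariance relation `a(V) U = U (α₁ a)(V)`: by density of the trigonometric polynomials it
follows from `V U = e^{2πiθ} U V`. -/
theorem unitaryCalc_mul_U (θ : ℝ) (a : C(UnitAddCircle, ℂ)) :
    unitaryCalc (V θ) a * (U θ : NCTorus θ) =
      (U θ : NCTorus θ) * unitaryCalc (V θ) (rotate θ 1 a) := by
  let L1 : C(UnitAddCircle, ℂ) →L[ℂ] NCTorus θ :=
    { toFun := fun a => unitaryCalc (V θ) a * (U θ : NCTorus θ)
      map_add' := fun a b => by rw [map_add, add_mul]
      map_smul' := fun c a => by rw [map_smul, smul_mul_assoc]; rfl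
      cont := (continuous_unitaryCalc _).mul continuous_const }
  let L2 : C(UnitAddCircle, ℂ) →L[ℂ] NCTorus θ :=
    { toFun := fun a => (U θ : NCTorus θ) * unitaryCalc (V θ) (rotate θ 1 a)
      map_add' := fun a b => by
        have : rotate θ 1 (a + b) = rotate θ 1 a + rotate θ 1 b := rfl
        rw [this, map_add, mul_add]
      map_smul' := fun c a => by
        have : rotate θ 1 (c • a) = c • rotate θ 1 a := rfl
        rw [this, map_smul, mul_smul_comm]; rfl
      cont := continuous_const.mul ((continuous_unitaryCalc _).comp (continuous_rotate θ 1)) }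
  have h : L1 = L2 := by
    refine ContinuousLinearMap.ext_on (s := Set.range (fourier (T := (1 : ℝ)))) ?_ ?_
    · exact Submodule.dense_iff_topologicalClosure_eq_top.2 span_fourier_closure_eq_top
    · rintro _ ⟨k, rfl⟩
      exact unitaryCalc_mul_U_fourier θ k
  exact congrArg (fun L : C(UnitAddCircle, ℂ) →L[ℂ] NCTorus θ => L a) h

theorem unitaryCalc_mul_U_zpow (θ : ℝ) (k : ℤ) (a : C(UnitAddCircle, ℂ)) :
    unitaryCalc (V θ) a * ((U θ ^ k : unitary (NCTorus θ)) : NCTorus θ) =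
      ((U θ ^ k : unitary (NCTorus θ)) : NCTorus θ) * unitaryCalc (V θ) (rotate θ k a) := by
  have hneg : ∀ b : C(UnitAddCircle, ℂ),
      unitaryCalc (V θ) b * (((U θ)⁻¹ : unitary (NCTorus θ)) : NCTorus θ) =
      (((U θ)⁻¹ : unitary (NCTorus θ)) : NCTorus θ) * unitaryCalc (V θ) (rotate θ (-1) b) :=
    fun b => by
      have h := unitaryCalc_mul_U θ (rotate θ (-1) b)
      rw [rotate_rotate, add_neg_cancel, rotate_zero] at h
      have h' := congrArg (fun z : NCTorus θ => (((U θ)⁻¹ : unitary (NCTorus θ)) : NCTorus θ) * z *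
        (((U θ)⁻¹ : unitary (NCTorus θ)) : NCTorus θ)) h
      have hU : (U θ : NCTorus θ) * (((U θ)⁻¹ : unitary (NCTorus θ)) : NCTorus θ) = 1 := (U θ).2.2
      have hU' : (((U θ)⁻¹ : unitary (NCTorus θ)) : NCTorus θ) * (U θ : NCTorus θ) = 1 := (U θ).2.1
      simp only [mul_assoc, hU, mul_one] at h'
      rw [← mul_assoc, ← mul_assoc, hU', one_mul] at h'
      exact h'.symm
  induction k using Int.induction_on generalizing a with
  | zero => simp [rotate_zero]
  | succ k ih =>
    rw [zpow_add_one, Submonoid.coe_mul, ← mul_assoc, ih, mul_assoc, unitaryCalc_mul_U,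
      rotate_rotate, mul_assoc, add_comm]
  | pred k ih =>
    rw [zpow_sub_one, Submonoid.coe_mul, ← mul_assoc, ih, mul_assoc, hneg, rotate_rotate,
      mul_assoc, sub_eq_add_neg, add_comm]

/-- The element `U^k a(V)` of `A_θ`. -/
noncomputable def monomial (θ : ℝ) (k : ℤ) (a : C(UnitAddCircle, ℂ)) : NCTorus θ :=
  ((U θ ^ k : unitary (NCTorus θ)) : NCTorus θ) * unitaryCalc (V θ) a

theorem monomial_mul (θ : ℝ) (j k : ℤ) (a b : C(UnitAddCircle, ℂ)) :
    monomial θ j a * monomial θ k b = monomial θ (j + k) (rotate θ k a * b) := by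
  simp only [monomial]
  rw [mul_assoc, ← mul_assoc (unitaryCalc (V θ) a), unitaryCalc_mul_U_zpow, mul_assoc, ← map_mul,
    ← mul_assoc, ← Submonoid.coe_mul, ← zpow_add]

theorem star_monomial (θ : ℝ) (k : ℤ) (a : C(UnitAddCircle, ℂ)) :
    star (monomial θ k a) = monomial θ (-k) (rotate θ (-k) (star a)) := by
  simp only [monomial]
  rw [star_mul, ← map_star, ← Unitary.coe_star, Unitary.star_eq_inv, ← zpow_neg,
    unitaryCalc_mul_U_zpow]

theorem monomial_add (θ : ℝ) (k : ℤ) (a b : C(UnitAddCircle, ℂ)) :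
    monomial θ k (a + b) = monomial θ k a + monomial θ k b := by
  rw [monomial, map_add, mul_add]; rfl

theorem monomial_zero_right (θ : ℝ) (k : ℤ) : monomial θ k 0 = 0 := by
  rw [monomial, map_zero, mul_zero]

theorem fourierSum_add (θ : ℝ) (M : ℕ) (a b : ℤ → C(UnitAddCircle, ℂ)) :
    fourierSum θ M (a + b) = fourierSum θ M a + fourierSum θ M b := by
  simp only [fourierSum, Pi.add_apply, map_add, mul_add, Finset.sum_add_distrib]

theorem fourierSum_single (θ : ℝ) {M : ℕ} {k : ℤ} (hk : k ∈ Finset.Icc (-(M : ℤ)) M)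
    (a : C(UnitAddCircle, ℂ)) :
    fourierSum θ M (Pi.single k a) = monomial θ k a := by
  rw [fourierSum, Finset.sum_eq_single k, Pi.single_eq_same, monomial]
  · intro m _ hm
    rw [Pi.single_eq_of_ne hm, map_zero, mul_zero]
  · exact fun h => absurd hk h

theorem fourierSum_one_sub (θ : ℝ) (M : ℕ) (a : ℤ → C(UnitAddCircle, ℂ)) :
    fourierSum θ M (Pi.single 0 1 - a) = 1 - fourierSum θ M a := by
  have h : fourierSum θ M (Pi.single 0 1 - a) + fourierSum θ M a = 1 := by
    rw [← fourierSum_add, sub_add_cancel, fourierSum_single θ (by simp), monomial]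
    simp
  exact eq_sub_of_add_eq h

end NCTorus

/-! ### Projections with two off-diagonal terms -/

/-- If `f` is self-adjoint, `s`, `t` move orthogonal pieces of the space to orthogonal pieces, and
on the pieces moved the sum `f + s + s* + t + t*` is a `2 × 2` projection matrix, then the
sum is a projection. -/
theorem isStarProjection_add_add_star {A : Type*} [Ring A] [StarRing A] {f s t : A}
    (hf : star f = f) (hss : s * s = 0) (htt : t * t = 0) (hst : s * t = 0) (hts : t * s = 0)
    (hst' : s * star t = 0) (hst'' : star s * t = 0)
    (hfs : f * s + s * f = s) (hft : f * t + t * f = t)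
    (hdiag : f * f + s * star s + star s * s + t * star t + star t * t = f) :
    IsStarProjection (f + s + star s + t + star t) := by
  have h1 : star s * star s = 0 := by rw [← star_mul, hss, star_zero]
  have h2 : star t * star t = 0 := by rw [← star_mul, htt, star_zero]
  have h3 : star t * star s = 0 := by rw [← star_mul, hst, star_zero]
  have h4 : star s * star t = 0 := by rw [← star_mul, hts, star_zero]
  have h5 : t * star s = 0 := by
    have := congrArg star hst'
    rwa [star_mul, star_star, star_zero] at this
  have h6 : star t * s = 0 := by
    have := congrArg star hst''
    rwa [star_mul, star_star, star_zero] at this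
  have h7 : f * star s + star s * f = star s := by
    have := congrArg star hfs
    rwa [star_add, star_mul, star_mul, hf, add_comm] at this
  have h8 : f * star t + star t * f = star t := by
    have := congrArg star hft
    rwa [star_add, star_mul, star_mul, hf, add_comm] at this
  refine ⟨?_, ?_⟩
  · have expand : (f + s + star s + t + star t) * (f + s + star s + t + star t) =
        (f * f + s * star s + star s * s + t * star t + star t * t) + (f * s + s * f)
        + (f * star s + star s * f) + (f * t + t * f) + (f * star t + star t * f)
        + (s * s + s * t + s * star t + star s * star s + star s * t + star s * star t
          + t * s + t * star s + t * t + star t * s + star t * star s + star t * star t) := by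
      noncomm_ring
    rw [IsIdempotentElem, expand, hdiag, hfs, h7, hft, h8, hss, hst, hst', h1, hst'', h4, hts, h5,
      htt, h6, h3, h2]
    simp
  · rw [IsSelfAdjoint]
    simp only [star_add, star_star, hf]
    abel

namespace NCTorus

/-- The element `f(V) + U g(V) + (U g(V))* + U^M h(V) + (U^M h(V))*`. -/
noncomputable def twoStep (θ : ℝ) (M : ℕ) (f g h : C(UnitAddCircle, ℂ)) : NCTorus θ :=
  monomial θ 0 f + monomial θ 1 g + star (monomial θ 1 g) + monomial θ M h +
    star (monomial θ M h)

theorem twoStep_eq_fourierSum (θ : ℝ) {M : ℕ} (hM : 1 ≤ M) (f g h : C(UnitAddCircle, ℂ)) :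
    twoStep θ M f g h = fourierSum θ M (Pi.single 0 f + Pi.single 1 g +
      Pi.single (-1) (rotate θ (-1) (star g)) + Pi.single (M : ℤ) h +
      Pi.single (-(M : ℤ)) (rotate θ (-M) (star h))) := by
  simp only [fourierSum_add, twoStep, star_monomial]
  rw [fourierSum_single, fourierSum_single, fourierSum_single, fourierSum_single,
    fourierSum_single]
  all_goals
    rw [Finset.mem_Icc]
    omega

/-- The pointwise conditions on `f`, `g`, `h` under which `twoStep` is a projection: each orbit of
the rotation by `θ` splits into blocks of size one and two, on which the matrix is a projection. -/
theorem isStarProjection_twoStep (θ : ℝ) (M : ℕ) {f g h : C(UnitAddCircle, ℂ)}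
    (hf : star f = f) (hg : star g = g) (hh : star h = h)
    (hgg : rotate θ 1 g * g = 0) (hhh : rotate θ M h * h = 0)
    (hgh : rotate θ M g * h = 0) (hhg : rotate θ 1 h * g = 0)
    (hgh0 : g * h = 0) (hgh' : rotate θ (M - 1) g * h = 0)
    (hfg : (rotate θ 1 f + f) * g = g) (hfh : (rotate θ M f + f) * h = h)
    (hdiag : f * f + rotate θ (-1) (g * g) + g * g + rotate θ (-M) (h * h) + h * h = f) :
    IsStarProjection (twoStep θ M f g h) := by
  apply isStarProjection_add_add_star
  · rw [star_monomial, hf, neg_zero, rotate_zero]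
  · rw [monomial_mul, hgg, monomial_zero_right]
  · rw [monomial_mul, hhh, monomial_zero_right]
  · rw [monomial_mul, hgh, monomial_zero_right]
  · rw [monomial_mul, hhg, monomial_zero_right]
  · rw [star_monomial, monomial_mul, hh, ← rotate_mul, hgh0]
    exact monomial_zero_right _ _
  · rw [star_monomial, monomial_mul, hg, rotate_rotate, ← sub_eq_add_neg, hgh',
      monomial_zero_right]
  · rw [monomial_mul, monomial_mul, rotate_zero, zero_add, add_zero, ← monomial_add,
      mul_comm g f, ← add_mul, hfg]
  · rw [monomial_mul, monomial_mul, rotate_zero, zero_add, add_zero, ← monomial_add,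
      mul_comm h f, ← add_mul, hfh]
  · have key : ∀ (k : ℤ) (b : C(UnitAddCircle, ℂ)), star b = b →
        monomial θ k b * star (monomial θ k b) = monomial θ 0 (rotate θ (-k) (b * b)) ∧
        star (monomial θ k b) * monomial θ k b = monomial θ 0 (b * b) := fun k b hb => by
      rw [star_monomial, monomial_mul, monomial_mul, hb, rotate_rotate, add_neg_cancel,
        neg_add_cancel, rotate_zero, rotate_mul]
      exact ⟨rfl, rfl⟩
    rw [(key _ g hg).1, (key _ g hg).2, (key _ h hh).1, (key _ h hh).2, monomial_mul, rotate_zero,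
      add_zero, ← monomial_add, ← monomial_add, ← monomial_add, ← monomial_add, hdiag]

end NCTorus

/-! ### The functions on the line -/

namespace ProjectionProfile

/-- The trapezoid that rises from `0` to `1` on `[0, ε]` and falls back on `[θ, θ + ε]`. -/
noncomputable def trapezoid (θ ε y : ℝ) : ℝ := max 0 (min 1 (min (y / ε) ((θ + ε - y) / ε)))

/-- The function `√(b(1 - b))` on the rising part `[0, ε]` of the trapezoid `b`. It vanishes
elsewhere, because `Real.sqrt` does so on negative numbers. -/
noncomputable def arc (ε y : ℝ) : ℝ := √(y * (ε - y)) / ε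

/-- A nonnegative hump with support `[0, κ]` and values at most `1/4`. -/
noncomputable def hump (κ y : ℝ) : ℝ := max 0 (y * (κ - y) / κ ^ 2)

/-- The sum of the translates of `φ` by `0, d, …, (n - 1) d`. -/
noncomputable def translates (n : ℕ) (d : ℝ) (φ : ℝ → ℝ) (x : ℝ) : ℝ :=
  ∑ i ∈ Finset.range n, φ (x - i * d)

section Shapes

variable {θ ε κ y : ℝ}

theorem continuous_trapezoid (θ ε : ℝ) : Continuous (trapezoid θ ε) := by
  unfold trapezoid; fun_prop

theorem continuous_arc (ε : ℝ) : Continuous (arc ε) := by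
  unfold arc; fun_prop

theorem continuous_hump (κ : ℝ) : Continuous (hump κ) := by
  unfold hump; fun_prop

theorem continuous_translates (n : ℕ) (d : ℝ) {φ : ℝ → ℝ} (hφ : Continuous φ) :
    Continuous (translates n d φ) := by
  unfold translates; fun_prop

theorem trapezoid_rise (hε : 0 < ε) (hεθ : ε ≤ θ) (h0 : 0 ≤ y) (h1 : y ≤ ε) :
    trapezoid θ ε y = y / ε := by
  have a : y / ε ≤ 1 := (div_le_one hε).2 h1
  have b : y / ε ≤ (θ + ε - y) / ε := div_le_div_of_nonneg_right (by linarith) hε.le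
  rw [trapezoid, min_eq_left b, min_eq_right a, max_eq_right (by positivity)]

theorem trapezoid_top (hε : 0 < ε) (h0 : ε ≤ y) (h1 : y ≤ θ) : trapezoid θ ε y = 1 := by
  have a : 1 ≤ y / ε := (one_le_div hε).2 h0
  have b : 1 ≤ (θ + ε - y) / ε := (one_le_div hε).2 (by linarith)
  rw [trapezoid, min_eq_left (le_min a b), max_eq_right zero_le_one]

theorem trapezoid_fall (hε : 0 < ε) (hεθ : ε ≤ θ) (h0 : θ ≤ y) (h1 : y ≤ θ + ε) :
    trapezoid θ ε y = (θ + ε - y) / ε := by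
  have a : (θ + ε - y) / ε ≤ 1 := (div_le_one hε).2 (by linarith)
  have b : (θ + ε - y) / ε ≤ y / ε := div_le_div_of_nonneg_right (by linarith) hε.le
  rw [trapezoid, min_eq_right b, min_eq_right a,
    max_eq_right (div_nonneg (by linarith) hε.le)]

theorem trapezoid_of_nonpos (hε : 0 < ε) (h : y ≤ 0) : trapezoid θ ε y = 0 := by
  refine max_eq_left ((min_le_right _ _).trans ((min_le_left _ _).trans ?_))
  exact div_nonpos_of_nonpos_of_nonneg h hε.le

theorem trapezoid_of_le (hε : 0 < ε) (h : θ + ε ≤ y) : trapezoid θ ε y = 0 := by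
  refine max_eq_left ((min_le_right _ _).trans ((min_le_right _ _).trans ?_))
  exact div_nonpos_of_nonpos_of_nonneg (by linarith) hε.le

theorem arc_of_nonpos (hε : 0 < ε) (h : y ≤ 0) : arc ε y = 0 := by
  rw [arc, Real.sqrt_eq_zero'.2 (mul_nonpos_of_nonpos_of_nonneg h (by linarith)), zero_div]

theorem arc_of_le (hε : 0 < ε) (h : ε ≤ y) : arc ε y = 0 := by
  rw [arc, Real.sqrt_eq_zero'.2 (mul_nonpos_of_nonneg_of_nonpos (by linarith) (by linarith)),
    zero_div]

theorem arc_sq (h0 : 0 ≤ y) (h1 : y ≤ ε) : arc ε y ^ 2 = y * (ε - y) / ε ^ 2 := by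
  rw [arc, div_pow, Real.sq_sqrt (mul_nonneg h0 (by linarith))]

/-- The trapezoid and the arc are related as the entries of a `2 × 2` projection matrix. -/
theorem trapezoid_sq_add_arc_sq (hε : 0 < ε) (hεθ : ε ≤ θ) (h0 : 0 ≤ y) (h1 : y ≤ θ + ε) :
    trapezoid θ ε y ^ 2 + arc ε y ^ 2 + arc ε (y - θ) ^ 2 = trapezoid θ ε y := by
  rcases le_total y ε with h | h
  · rw [trapezoid_rise hε hεθ h0 h, arc_sq h0 h, arc_of_nonpos hε (by linarith)]
    field_simp
    ring
  rcases le_total y θ with h' | h'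
  · rw [trapezoid_top hε h h', arc_of_le hε h, arc_of_nonpos hε (by linarith)]
    norm_num
  · rw [trapezoid_fall hε hεθ h' h1, arc_of_le hε h, arc_sq (by linarith) (by linarith)]
    field_simp
    ring

theorem hump_of_nonpos (h0 : 0 < κ) (h : y ≤ 0) : hump κ y = 0 :=
  max_eq_left (div_nonpos_of_nonpos_of_nonneg
    (mul_nonpos_of_nonpos_of_nonneg h (by linarith)) (sq_nonneg κ))

theorem hump_of_le (h0 : 0 < κ) (h : κ ≤ y) : hump κ y = 0 :=
  max_eq_left (div_nonpos_of_nonpos_of_nonneg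
    (mul_nonpos_of_nonneg_of_nonpos (by linarith) (by linarith)) (sq_nonneg κ))

theorem hump_nonneg (κ y : ℝ) : 0 ≤ hump κ y := le_max_left _ _

theorem hump_le_one (h0 : 0 < κ) (y : ℝ) : hump κ y ≤ 1 := by
  refine max_le zero_le_one ?_
  rw [div_le_one (by positivity)]
  nlinarith [sq_nonneg (2 * y - κ), sq_nonneg κ]

theorem hump_half (h0 : 0 < κ) : hump κ (κ / 2) = 1 / 4 := by
  have : κ / 2 * (κ - κ / 2) / κ ^ 2 = 1 / 4 := by field_simp; ring
  rw [hump, this]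
  norm_num

open MeasureTheory in
theorem integral_trapezoid (hε : 0 < ε) (hεθ : ε ≤ θ) : ∫ y, trapezoid θ ε y = θ := by
  have hc := continuous_trapezoid θ ε
  have hi : ∀ a b, IntervalIntegrable (trapezoid θ ε) volume a b := fun a b =>
    hc.intervalIntegrable a b
  have hsupp : Function.support (trapezoid θ ε) ⊆ Set.Ioc 0 (θ + ε) := fun y hy => by
    by_contra hy'
    rw [Set.mem_Ioc, not_and_or, not_lt, not_le] at hy'
    rcases hy' with h | h
    · exact hy (trapezoid_of_nonpos hε h)
    · exact hy (trapezoid_of_le hε h.le)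
  have h2 : ∫ y in ε..θ, trapezoid θ ε y = θ - ε := by
    rw [intervalIntegral.integral_congr (g := fun _ => (1 : ℝ))]
    · simp
    · intro y hy
      rw [Set.uIcc_of_le hεθ] at hy
      exact trapezoid_top hε hy.1 hy.2
  -- the falling part, moved by `-θ`, complements the rising part
  have h3 : ∫ y in θ..(θ + ε), trapezoid θ ε y = ∫ y in (0 : ℝ)..ε, trapezoid θ ε (y + θ) := by
    rw [intervalIntegral.integral_comp_add_right]
    simp [add_comm]
  have h4 : (∫ y in (0 : ℝ)..ε, trapezoid θ ε y) + ∫ y in (0 : ℝ)..ε, trapezoid θ ε (y + θ) = ε := by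
    have hi' : IntervalIntegrable (fun y => trapezoid θ ε (y + θ)) volume 0 ε :=
      (hc.comp (continuous_add_const θ)).intervalIntegrable _ _
    rw [← intervalIntegral.integral_add (hi _ _) hi',
      intervalIntegral.integral_congr (g := fun _ => (1 : ℝ))]
    · simp
    · intro y hy
      rw [Set.uIcc_of_le hε.le] at hy
      change trapezoid θ ε y + trapezoid θ ε (y + θ) = 1
      rw [trapezoid_rise hε hεθ hy.1 hy.2,
        trapezoid_fall hε hεθ (by linarith [hy.1]) (by linarith [hy.2])]
      field_simp
      ring
  rw [← intervalIntegral.integral_eq_integral_of_support_subset hsupp,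
    ← intervalIntegral.integral_add_adjacent_intervals (hi 0 ε) (hi ε _),
    ← intervalIntegral.integral_add_adjacent_intervals (hi ε θ) (hi θ _), h2, h3]
  linarith

end Shapes

section Translates

variable {n : ℕ} {d : ℝ} {φ : ℝ → ℝ}

theorem translates_of_nonpos (hd : 0 ≤ d) (h0 : ∀ y ≤ 0, φ y = 0) {x : ℝ} (hx : x ≤ 0) :
    translates n d φ x = 0 :=
  Finset.sum_eq_zero fun i _ => h0 _ (by nlinarith [Nat.cast_nonneg (α := ℝ) i])

theorem translates_of_le (hd : 0 ≤ d) {e : ℝ} (h1 : ∀ y, e ≤ y → φ y = 0) {x : ℝ}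
    (hx : n * d + e ≤ x + d) : translates n d φ x = 0 := by
  refine Finset.sum_eq_zero fun i hi => h1 _ ?_
  have : (i : ℝ) + 1 ≤ n := by exact_mod_cast Finset.mem_range.1 hi
  nlinarith

theorem translates_eq (hd : 0 ≤ d) (h0 : ∀ y ≤ 0, φ y = 0) (h1 : ∀ y, d ≤ y → φ y = 0)
    {j : ℕ} (hj : j < n) {y : ℝ} (hy0 : 0 ≤ y) (hy1 : y ≤ d) :
    translates n d φ (j * d + y) = φ y := by
  rw [translates, Finset.sum_eq_single j]
  · congr 1; ring
  · intro i _ hij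
    rcases lt_or_gt_of_ne hij with h | h
    · have : (i : ℝ) + 1 ≤ j := by exact_mod_cast h
      exact h1 _ (by nlinarith)
    · have : (j : ℝ) + 1 ≤ i := by exact_mod_cast h
      exact h0 _ (by nlinarith)
  · exact fun h => absurd (Finset.mem_range.2 hj) h

theorem nonpos_or_le_or_exists_eq (n : ℕ) (hd : 0 < d) (x : ℝ) :
    x ≤ 0 ∨ n * d ≤ x ∨ ∃ j < n, ∃ y, 0 ≤ y ∧ y ≤ d ∧ x = j * d + y := by
  rcases le_or_gt x 0 with h | h
  · exact Or.inl h
  rcases le_or_gt (n * d) x with h' | h'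
  · exact Or.inr (Or.inl h')
  have a := Nat.floor_le (div_nonneg h.le hd.le)
  have b := Nat.lt_floor_add_one (x / d)
  rw [le_div_iff₀ hd] at a
  rw [div_lt_iff₀ hd] at b
  refine Or.inr (Or.inr ⟨⌊x / d⌋₊, ?_, x - ⌊x / d⌋₊ * d, by linarith, by linarith, by ring⟩)
  rw [Nat.floor_lt (by positivity), div_lt_iff₀ hd]
  exact h'

end Translates

/-- The conditions on real functions `f`, `g`, `h` on the line, supported in `[0, 1]`, under which
`f + (U g + h.c.) + (U^M h + h.c.)` is a projection of `A_θ`, where `U` is the translation by `θ`.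
The supports of `g` and `h` are such that the translations by `θ` and `Mθ`, respectively, do not
move them out of `[0, 1]`; so the conditions may be checked on the line instead of the circle. -/
structure IsProfile (θ : ℝ) (M : ℕ) (f g h : ℝ → ℝ) : Prop where
  continuous_f : Continuous f
  continuous_g : Continuous g
  continuous_h : Continuous h
  f_eq_zero : ∀ x, x ≤ 0 ∨ 1 ≤ x → f x = 0
  g_eq_zero : ∀ x, x ≤ 0 ∨ 1 ≤ x + θ → g x = 0
  h_eq_zero : ∀ x, x ≤ 0 ∨ 1 ≤ x + M * θ → h x = 0
  g_add : ∀ x, g x ≠ 0 → g (x + θ) = 0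
  h_add : ∀ x, h x ≠ 0 → h (x + M * θ) = 0
  g_add_of_h : ∀ x, h x ≠ 0 → g (x + M * θ) = 0
  g_of_h_add : ∀ x, h (x + θ) ≠ 0 → g x = 0
  g_of_h : ∀ x, h x ≠ 0 → g x = 0
  g_add_sub_of_h : ∀ x, h x ≠ 0 → g (x + M * θ - θ) = 0
  f_add_of_g : ∀ x, g x ≠ 0 → f x + f (x + θ) = 1
  f_add_of_h : ∀ x, h x ≠ 0 → f x + f (x + M * θ) = 1
  diag : ∀ x, f x ^ 2 + g (x - θ) ^ 2 + g x ^ 2 + h (x - M * θ) ^ 2 + h x ^ 2 = f x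

set_option maxHeartbeats 1000000 in
/-- On the line, `f` consists of `n` trapezoids of area `θ`, with `g` living on their rising
slopes, except that `f` is lowered by a hump inside one plateau and raised by the same hump at
distance `Mθ`, in the gap behind the last trapezoid; `h` lives on the first of these humps. The
first one lies in the plateau of index `n - M`, or `0` if `n ≤ M`, and the gap has room for the
second one because `max(n, M) θ < 1`. -/
theorem exists_isProfile {θ : ℝ} {M n : ℕ} (hn : 1 ≤ n) (hM : 1 ≤ M) (hθ : 0 < θ)
    (hnθ : n * θ < 1) (hMθ : M * θ < 1) :
    ∃ f g h : ℝ → ℝ, IsProfile θ M f g h ∧ (∃ x, h x ≠ 0) ∧ ∫ x, f x = n * θ := by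
  have hn1 : (1 : ℝ) ≤ n := by exact_mod_cast hn
  have hM1 : (1 : ℝ) ≤ M := by exact_mod_cast hM
  -- `4κ` fits below `θ` and into the gap that the translates of `[0, θ]` leave in `[0, 1]`
  obtain ⟨κ, hκ0, hκθ, hκn, hκM⟩ :
      ∃ κ : ℝ, 0 < κ ∧ 4 * κ ≤ θ ∧ n * θ + 4 * κ ≤ 1 ∧ M * θ + 4 * κ ≤ 1 := by
    have hpos : 0 < min θ (min (1 - n * θ) (1 - M * θ)) :=
      lt_min hθ (lt_min (by linarith) (by linarith))
    have h1 := min_le_left θ (min (1 - n * θ) (1 - M * θ))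
    have h2 := min_le_right θ (min (1 - n * θ) (1 - M * θ))
    have h3 := min_le_left (1 - n * θ) (1 - M * θ)
    have h4 := min_le_right (1 - n * θ) (1 - M * θ)
    exact ⟨min θ (min (1 - n * θ) (1 - M * θ)) / 4, by linarith, by linarith, by linarith,
      by linarith⟩
  obtain ⟨ε, hε0, hnε⟩ : ∃ ε : ℝ, 0 < ε ∧ n * ε = κ / 2 :=
    ⟨κ / 2 / n, by positivity, by field_simp⟩
  have hεκ : ε < κ := by nlinarith
  have hεθ : ε ≤ θ := by linarith
  obtain ⟨d, hd⟩ : ∃ d, d = θ + ε := ⟨_, rfl⟩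
  have hd0 : 0 < d := by linarith
  have hnd : n * d = n * θ + κ / 2 := by rw [hd, mul_add, hnε]
  -- the hump starts at `c`, in the plateau of the trapezoid of index `i`; translated by `Mθ`,
  -- it lands in the gap behind the last trapezoid
  obtain ⟨i, hin, hi1, hi2⟩ : ∃ i : ℕ, i < n ∧ (n : ℝ) ≤ i + M ∧ i * d + M * θ + 3 * κ < 1 := by
    refine ⟨n - M, by omega, ?_, ?_⟩
    · have : n ≤ n - M + M := by omega
      exact_mod_cast this
    · rcases le_total n M with h | h
      · rw [Nat.sub_eq_zero_of_le h]
        push_cast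
        linarith
      · rw [Nat.cast_sub h]
        nlinarith
  have hi0 : (0 : ℝ) ≤ i := i.cast_nonneg
  have hid0 : 0 ≤ i * d := mul_nonneg hi0 hd0.le
  obtain ⟨c, hc⟩ : ∃ c, c = i * d + κ := ⟨_, rfl⟩
  have hMθκ : 4 * κ ≤ M * θ := by nlinarith
  have hθM : θ ≤ M * θ := by nlinarith
  have hcn : n * d < c + M * θ := by
    rw [hnd, hc, hd]
    nlinarith
  have hc1 : c + κ + M * θ < 1 := by linarith
  obtain ⟨b, hb⟩ : ∃ b, b = translates n d (trapezoid θ ε) := ⟨_, rfl⟩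
  obtain ⟨g, hg⟩ : ∃ g, g = translates n d (arc ε) := ⟨_, rfl⟩
  obtain ⟨m, hm⟩ : ∃ m : ℝ → ℝ, m = fun x => hump κ (x - c) := ⟨_, rfl⟩
  have hmc : Continuous m := hm ▸ (continuous_hump κ).comp (continuous_sub_right c)
  have hbc : Continuous b := hb ▸ continuous_translates n d (continuous_trapezoid θ ε)
  have hgc : Continuous g := hg ▸ continuous_translates n d (continuous_arc ε)
  have hm_left : ∀ x ≤ c, m x = 0 := fun x hx => by
    rw [hm]; exact hump_of_nonpos hκ0 (by linarith)
  have hm_right : ∀ x, c + κ ≤ x → m x = 0 := fun x hx => by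
    rw [hm]; exact hump_of_le hκ0 (by linarith)
  have hm_ne : ∀ x, m x ≠ 0 → c < x ∧ x < c + κ := fun x hx => by
    constructor
    · by_contra hy
      exact hx (hm_left x (not_lt.1 hy))
    · by_contra hy
      exact hx (hm_right x (not_lt.1 hy))
  have hb_left : ∀ x ≤ 0, b x = 0 := fun x hx => by
    rw [hb]; exact translates_of_nonpos hd0.le (fun y hy => trapezoid_of_nonpos hε0 hy) hx
  have hb_right : ∀ x, n * d ≤ x → b x = 0 := fun x hx => by
    rw [hb]
    exact translates_of_le hd0.le (fun y hy => trapezoid_of_le hε0 (hd ▸ hy)) (by linarith)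
  have hb_eq : ∀ j < n, ∀ y, 0 ≤ y → y ≤ d → b (j * d + y) = trapezoid θ ε y :=
    fun j hj y h0 h1 => by
      rw [hb]
      exact translates_eq hd0.le (fun y hy => trapezoid_of_nonpos hε0 hy)
        (fun y hy => trapezoid_of_le hε0 (hd ▸ hy)) hj h0 h1
  have hg_left : ∀ x ≤ 0, g x = 0 := fun x hx => by
    rw [hg]; exact translates_of_nonpos hd0.le (fun y hy => arc_of_nonpos hε0 hy) hx
  have hg_right : ∀ x, n * d ≤ x + θ → g x = 0 := fun x hx => by
    rw [hg]
    exact translates_of_le hd0.le (fun y hy => arc_of_le hε0 hy) (by linarith)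
  have hg_eq : ∀ j < n, ∀ y, 0 ≤ y → y ≤ d → g (j * d + y) = arc ε y :=
    fun j hj y h0 h1 => by
      rw [hg]
      exact translates_eq hd0.le (fun y hy => arc_of_nonpos hε0 hy)
        (fun y hy => arc_of_le hε0 (by linarith)) hj h0 h1
  have hg_ne : ∀ x, g x ≠ 0 → ∃ j < n, ∃ y, 0 < y ∧ y < ε ∧ x = j * d + y := fun x hx => by
    rcases nonpos_or_le_or_exists_eq n hd0 x with h | h | ⟨j, hj, y, h0, h1, rfl⟩
    · exact absurd (hg_left x h) hx
    · exact absurd (hg_right x (by linarith)) hx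
    · rw [hg_eq j hj y h0 h1] at hx
      refine ⟨j, hj, y, ?_, ?_, rfl⟩
      · by_contra hy
        exact hx (arc_of_nonpos hε0 (not_lt.1 hy))
      · by_contra hy
        exact hx (arc_of_le hε0 (not_lt.1 hy))
  have hg_sub : ∀ j < n, ∀ y, 0 ≤ y → y ≤ d → g (j * d + y - θ) = arc ε (y - θ) :=
    fun j hj y h0 h1 => by
      rcases le_total θ y with h | h
      · rw [add_sub_assoc, hg_eq j hj _ (by linarith) (by linarith)]
      · rw [arc_of_nonpos hε0 (by linarith)]
        by_contra hne
        obtain ⟨k, hk, z, hz0, hz1, hz⟩ := hg_ne _ hne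
        rcases lt_or_ge k j with hkj | hkj
        · have : (k : ℝ) + 1 ≤ j := by exact_mod_cast hkj
          nlinarith
        · have : (j : ℝ) ≤ k := by exact_mod_cast hkj
          nlinarith
  -- the hump stays away from the slopes of the trapezoids
  have hgm : ∀ x, c < x → x < c + κ → g x = 0 ∧ g (x - θ) = 0 ∧ b x = 1 := fun x h0 h1 => by
    have e : x = i * d + (x - i * d) := by ring
    have h0' : κ < x - i * d := by linarith
    have h1' : x - i * d < 2 * κ := by linarith
    rw [e, hg_eq i hin _ (by linarith) (by linarith), hg_sub i hin _ (by linarith) (by linarith),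
      hb_eq i hin _ (by linarith) (by linarith), arc_of_le hε0 (by linarith),
      arc_of_nonpos hε0 (by linarith), trapezoid_top hε0 (by linarith) (by linarith)]
    exact ⟨rfl, rfl, rfl⟩
  obtain ⟨h, hh⟩ : ∃ h : ℝ → ℝ, h = fun x => √(m x * (1 - m x)) := ⟨_, rfl⟩
  have hhc : Continuous h := by rw [hh]; fun_prop
  have hh_sq : ∀ x, h x ^ 2 = m x * (1 - m x) := fun x => by
    rw [hh]
    refine Real.sq_sqrt (mul_nonneg ?_ (sub_nonneg.2 ?_))
    · rw [hm]; exact hump_nonneg _ _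
    · rw [hm]; exact hump_le_one hκ0 _
  have hh_zero : ∀ x, m x = 0 → h x = 0 := fun x hx => by
    rw [hh]; simp [hx]
  have hh_ne : ∀ x, h x ≠ 0 → c < x ∧ x < c + κ := fun x hx => hm_ne x (mt (hh_zero x) hx)
  refine ⟨fun x => b x - m x + m (x - M * θ), g, h, ⟨by fun_prop, hgc, hhc, ?_, ?_, ?_, ?_, ?_, ?_,
    ?_, ?_, ?_, ?_, ?_, ?_⟩, ?_, ?_⟩
  · rintro x (hx | hx)
    · rw [hb_left x hx, hm_left x (by linarith), hm_left _ (by linarith)]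
      norm_num
    · rw [hb_right x (by linarith), hm_right x (by linarith), hm_right _ (by linarith)]
      norm_num
  · rintro x (hx | hx)
    · exact hg_left x hx
    · exact hg_right x (by linarith)
  · rintro x (hx | hx)
    · exact hh_zero x (hm_left x (by linarith))
    · exact hh_zero x (hm_right x (by linarith))
  · intro x hx
    obtain ⟨j, hj, y, h0, h1, rfl⟩ := hg_ne x hx
    rw [add_assoc, hg_eq j hj _ (by linarith) (by linarith), arc_of_le hε0 (by linarith)]
  · intro x hx
    obtain ⟨h0, h1⟩ := hh_ne x hx
    exact hh_zero _ (hm_right _ (by linarith))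
  · intro x hx
    obtain ⟨h0, h1⟩ := hh_ne x hx
    exact hg_right _ (by linarith)
  · intro x hx
    obtain ⟨h0, h1⟩ := hh_ne _ hx
    simpa using (hgm _ h0 h1).2.1
  · intro x hx
    obtain ⟨h0, h1⟩ := hh_ne _ hx
    exact (hgm _ h0 h1).1
  · intro x hx
    obtain ⟨h0, h1⟩ := hh_ne _ hx
    exact hg_right _ (by linarith)
  · intro x hx
    have hmx : m x = 0 := by
      by_contra hne
      obtain ⟨h0, h1⟩ := hm_ne x hne
      exact hx (hgm x h0 h1).1
    have hmx' : m (x + θ) = 0 := by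
      by_contra hne
      obtain ⟨h0, h1⟩ := hm_ne _ hne
      exact hx (by simpa using (hgm _ h0 h1).2.1)
    obtain ⟨j, hj, y, h0, h1, rfl⟩ := hg_ne x hx
    have hjn : (j : ℝ) + 1 ≤ n := by exact_mod_cast hj
    have hjd : j * d + d ≤ n * d := by nlinarith
    rw [hmx, hmx', hm_left (j * d + y - M * θ) (by linarith),
      hm_left (j * d + y + θ - M * θ) (by linarith), add_assoc _ y θ,
      hb_eq j hj _ h0.le (by linarith), hb_eq j hj _ (by linarith) (by linarith),
      trapezoid_rise hε0 hεθ h0.le h1.le,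
      trapezoid_fall hε0 hεθ (by linarith) (by linarith)]
    field_simp
    ring
  · intro x hx
    obtain ⟨h0, h1⟩ := hh_ne _ hx
    rw [add_sub_cancel_right, (hgm x h0 h1).2.2, hm_left (x - M * θ) (by linarith),
      hb_right (x + M * θ) (by linarith), hm_right (x + M * θ) (by linarith)]
    ring
  · intro x
    rw [hh_sq, hh_sq]
    by_cases h1 : c < x ∧ x < c + κ
    · obtain ⟨e1, e2, e3⟩ := hgm x h1.1 h1.2
      rw [e1, e2, e3, hm_left (x - M * θ) (by linarith [h1.2])]
      ring
    have hmx : m x = 0 := by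
      rw [not_and_or, not_lt, not_lt] at h1
      exact h1.elim (hm_left x) (hm_right x)
    by_cases h2 : c < x - M * θ
    · rw [hmx, hb_right x (by linarith), hg_right x (by linarith), hg_right (x - θ) (by linarith)]
      ring
    rw [hmx, hm_left _ (not_lt.1 h2)]
    rcases nonpos_or_le_or_exists_eq n hd0 x with hx | hx | ⟨j, hj, y, hy0, hy1, rfl⟩
    · rw [hb_left x hx, hg_left x hx, hg_left (x - θ) (by linarith)]
      ring
    · rw [hb_right x hx, hg_right x (by linarith), hg_right (x - θ) (by linarith)]
      ring
    · rw [hb_eq j hj y hy0 hy1, hg_eq j hj y hy0 hy1, hg_sub j hj y hy0 hy1]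
      linear_combination trapezoid_sq_add_arc_sq hε0 hεθ hy0 (hd ▸ hy1)
  · refine ⟨c + κ / 2, fun h0 => ?_⟩
    have h1 := hh_sq (c + κ / 2)
    have h2 : m (c + κ / 2) = 1 / 4 := by
      rw [hm]
      simp only [add_sub_cancel_left]
      exact hump_half hκ0
    rw [h0, h2] at h1
    norm_num at h1
  · have hcs : ∀ {φ : ℝ → ℝ} {r s : ℝ}, Continuous φ → (∀ x ≤ r, φ x = 0) →
        (∀ x, s ≤ x → φ x = 0) → MeasureTheory.Integrable φ := fun {φ r s} hφ h0 h1 =>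
      hφ.integrable_of_hasCompactSupport
        (HasCompactSupport.intro (isCompact_Icc (a := r) (b := s)) fun x hx => by
          rw [Set.mem_Icc, not_and_or, not_le, not_le] at hx
          exact hx.elim (fun hx => h0 x hx.le) fun hx => h1 x hx.le)
    have hmi := hcs hmc hm_left hm_right
    have hbi := hcs hbc hb_left hb_right
    have hti := hcs (continuous_trapezoid θ ε) (fun x hx => trapezoid_of_nonpos hε0 hx)
      (fun x hx => trapezoid_of_le hε0 hx)
    have e1 : ∫ x, (b x - m x + m (x - M * θ)) = (∫ x, (b x - m x)) + ∫ x, m (x - M * θ) :=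
      MeasureTheory.integral_add (hbi.sub hmi) (hmi.comp_sub_right _)
    rw [e1, MeasureTheory.integral_sub hbi hmi, MeasureTheory.integral_sub_right_eq_self m,
      sub_add_cancel, hb]
    simp only [translates]
    rw [MeasureTheory.integral_finsetSum _ fun j _ => hti.comp_sub_right _]
    simp only [MeasureTheory.integral_sub_right_eq_self (trapezoid θ ε),
      integral_trapezoid hε0 hεθ]
    simp

end ProjectionProfile

/-! ### From the line to the circle -/

/-- The continuous function on `ℝ/ℤ` given on `[0, 1)` by a function on the line that takes the
same value at `0` and `1`. -/
noncomputable def circleFunction (φ : ℝ → ℝ) (hc : Continuous φ) (h01 : φ 0 = φ 1) :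
    C(UnitAddCircle, ℂ) where
  toFun := AddCircle.liftIco 1 0 fun x => (φ x : ℂ)
  continuous_toFun := AddCircle.liftIco_continuous (by simp [h01])
    (Complex.continuous_ofReal.comp hc).continuousOn

theorem exists_coe_eq_unitAddCircle (z : UnitAddCircle) :
    ∃ x : ℝ, 0 ≤ x ∧ x < 1 ∧ (x : UnitAddCircle) = z := by
  have hz : z ∈ ((↑) : ℝ → UnitAddCircle) '' Set.Ico 0 (0 + 1) := by
    rw [AddCircle.coe_image_Ico_eq]
    trivial
  obtain ⟨x, ⟨h0, h1⟩, hx⟩ := hz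
  exact ⟨x, h0, by simpa using h1, hx⟩

section CircleFunction

variable {φ : ℝ → ℝ} {hc : Continuous φ} {h01 : φ 0 = φ 1}

theorem circleFunction_coe {x : ℝ} (h0 : 0 ≤ x) (h1 : x < 1) :
    circleFunction φ hc h01 (x : UnitAddCircle) = (φ x : ℂ) :=
  AddCircle.liftIco_coe_apply (f := fun x => (φ x : ℂ)) ⟨h0, by simpa using h1⟩

theorem star_circleFunction : star (circleFunction φ hc h01) = circleFunction φ hc h01 := by
  ext z
  obtain ⟨x, h0, h1, rfl⟩ := exists_coe_eq_unitAddCircle z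
  rw [ContinuousMap.star_apply, circleFunction_coe h0 h1]
  exact Complex.conj_ofReal _

theorem circleFunction_coe_sub {s x : ℝ} (hs1 : s ≤ 1)
    (hφ : ∀ x, x ≤ 0 ∨ 1 ≤ x + s → φ x = 0) (hs0 : 0 ≤ s) (h0 : 0 ≤ x) (h1 : x < 1) :
    circleFunction φ hc h01 ((x - s : ℝ) : UnitAddCircle) = (φ (x - s) : ℂ) := by
  rcases le_or_gt 0 (x - s) with h | h
  · exact circleFunction_coe h (by linarith)
  · have e : ((x - s : ℝ) : UnitAddCircle) = ((x - s + 1 : ℝ) : UnitAddCircle) := by simp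
    rw [e, circleFunction_coe (by linarith) (by linarith), hφ _ (Or.inl h.le),
      hφ _ (Or.inr (by linarith))]

theorem integral_circleFunction (hφ : ∀ x, x ≤ 0 ∨ 1 ≤ x → φ x = 0) :
    ∫ x in (0 : ℝ)..1, circleFunction φ hc h01 (x : UnitAddCircle) = ((∫ x, φ x : ℝ) : ℂ) := by
  have e : ∫ x in (0 : ℝ)..1, circleFunction φ hc h01 (x : UnitAddCircle) =
      ∫ x in (0 : ℝ)..1, (φ x : ℂ) := by
    refine intervalIntegral.integral_congr_ae' (Filter.Eventually.of_forall fun x hx => ?_)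
      (Filter.Eventually.of_forall fun x hx => ?_)
    · rcases hx.2.lt_or_eq with h | h
      · exact circleFunction_coe hx.1.le h
      · have : ((1 : ℝ) : UnitAddCircle) = ((0 : ℝ) : UnitAddCircle) := by simp
        rw [h, this, circleFunction_coe le_rfl one_pos, h01]
    · exact absurd (hx.1.trans_le hx.2) (by norm_num)
  rw [e, intervalIntegral.integral_ofReal, intervalIntegral.integral_eq_integral_of_support_subset]
  intro x hx
  by_contra hx'
  rw [Set.mem_Ioc, not_and_or, not_lt, not_le] at hx'
  exact hx (hφ x (hx'.imp_right le_of_lt))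

end CircleFunction

/-- The profile on the line, transferred to the circle, gives a projection; at some point `z`
the coefficient `h` does not vanish while `g` does, so that `h + g` is nonzero too. -/
theorem NCTorus.exists_twoStep {θ : ℝ} {M n : ℕ} (hn : 1 ≤ n) (hM : 1 ≤ M) (hθ : 0 < θ)
    (hnθ : n * θ < 1) (hMθ : M * θ < 1) :
    ∃ f g h : C(UnitAddCircle, ℂ), IsStarProjection (twoStep θ M f g h) ∧
      (∫ x in (0 : ℝ)..1, f (x : UnitAddCircle) = ((n * θ : ℝ) : ℂ)) ∧
      ∃ z, h z ≠ 0 ∧ g z = 0 := by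
  have hθM : θ ≤ M * θ := by
    have : (1 : ℝ) ≤ M := by exact_mod_cast hM
    nlinarith
  obtain ⟨f, g, h, ⟨hfc, hgc, hhc, hf0, hg0, hh0, hgg, hhh, hgh, hhg, hgh0, hgh', hfg, hfh, hdiag⟩,
    ⟨x₀, hx₀⟩, hint⟩ := ProjectionProfile.exists_isProfile hn hM hθ hnθ hMθ
  have f01 : f 0 = f 1 := by rw [hf0 0 (by simp), hf0 1 (by simp)]
  have g01 : g 0 = g 1 := by rw [hg0 0 (by simp), hg0 1 (Or.inr (by linarith))]
  have h01 : h 0 = h 1 := by rw [hh0 0 (by simp), hh0 1 (Or.inr (by linarith))]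
  have hg_lt : ∀ x, g x ≠ 0 → x + θ < 1 := fun x hx => by
    by_contra h1
    exact hx (hg0 x (Or.inr (not_lt.1 h1)))
  have hh_lt : ∀ x, h x ≠ 0 → x + M * θ < 1 := fun x hx => by
    by_contra h1
    exact hx (hh0 x (Or.inr (not_lt.1 h1)))
  refine ⟨circleFunction f hfc f01, circleFunction g hgc g01, circleFunction h hhc h01,
    isStarProjection_twoStep θ M star_circleFunction star_circleFunction star_circleFunction
      ?_ ?_ ?_ ?_ ?_ ?_ ?_ ?_ ?_, ?_, ?_⟩
  · ext z
    obtain ⟨x, h0, h1, rfl⟩ := exists_coe_eq_unitAddCircle z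
    rw [ContinuousMap.mul_apply, rotate_apply, ← AddCircle.coe_add, circleFunction_coe h0 h1]
    by_cases hx : g x = 0
    · simp [hx]
    · rw [circleFunction_coe (by push_cast; linarith) (by push_cast; linarith [hg_lt x hx])]
      push_cast
      rw [one_mul, hgg x hx]
      simp
  · ext z
    obtain ⟨x, h0, h1, rfl⟩ := exists_coe_eq_unitAddCircle z
    rw [ContinuousMap.mul_apply, rotate_apply, ← AddCircle.coe_add, circleFunction_coe h0 h1]
    by_cases hx : h x = 0
    · simp [hx]
    · rw [circleFunction_coe (by push_cast; linarith) (by push_cast; linarith [hh_lt x hx])]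
      push_cast
      rw [hhh x hx]
      simp
  · ext z
    obtain ⟨x, h0, h1, rfl⟩ := exists_coe_eq_unitAddCircle z
    rw [ContinuousMap.mul_apply, rotate_apply, ← AddCircle.coe_add, circleFunction_coe h0 h1]
    by_cases hx : h x = 0
    · simp [hx]
    · rw [circleFunction_coe (by push_cast; linarith) (by push_cast; linarith [hh_lt x hx])]
      push_cast
      rw [hgh x hx]
      simp
  · ext z
    obtain ⟨x, h0, h1, rfl⟩ := exists_coe_eq_unitAddCircle z
    rw [ContinuousMap.mul_apply, rotate_apply, ← AddCircle.coe_add, circleFunction_coe h0 h1]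
    by_cases hx : g x = 0
    · simp [hx]
    · rw [circleFunction_coe (by push_cast; linarith) (by push_cast; linarith [hg_lt x hx])]
      push_cast
      rw [one_mul, not_not.1 (mt (hhg x) hx)]
      simp
  · ext z
    obtain ⟨x, h0, h1, rfl⟩ := exists_coe_eq_unitAddCircle z
    rw [ContinuousMap.mul_apply, circleFunction_coe h0 h1, circleFunction_coe h0 h1]
    by_cases hx : h x = 0
    · simp [hx]
    · simp [hgh0 x hx]
  · ext z
    obtain ⟨x, h0, h1, rfl⟩ := exists_coe_eq_unitAddCircle z
    rw [ContinuousMap.mul_apply, rotate_apply, ← AddCircle.coe_add, circleFunction_coe h0 h1]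
    by_cases hx : h x = 0
    · simp [hx]
    · rw [circleFunction_coe (by push_cast; linarith) (by push_cast; linarith [hh_lt x hx])]
      push_cast
      have e : x + (M - 1) * θ = x + M * θ - θ := by ring
      rw [e, hgh' x hx]
      simp
  · ext z
    obtain ⟨x, h0, h1, rfl⟩ := exists_coe_eq_unitAddCircle z
    rw [ContinuousMap.mul_apply, ContinuousMap.add_apply, rotate_apply, ← AddCircle.coe_add,
      circleFunction_coe h0 h1, circleFunction_coe h0 h1]
    by_cases hx : g x = 0
    · simp [hx]
    · rw [circleFunction_coe (by push_cast; linarith) (by push_cast; linarith [hg_lt x hx]),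
        ← Complex.ofReal_add]
      push_cast
      rw [one_mul, ← Complex.ofReal_add, add_comm, hfg x hx]
      simp
  · ext z
    obtain ⟨x, h0, h1, rfl⟩ := exists_coe_eq_unitAddCircle z
    rw [ContinuousMap.mul_apply, ContinuousMap.add_apply, rotate_apply, ← AddCircle.coe_add,
      circleFunction_coe h0 h1, circleFunction_coe h0 h1]
    by_cases hx : h x = 0
    · simp [hx]
    · rw [circleFunction_coe (by push_cast; linarith) (by push_cast; linarith [hh_lt x hx]),
        ← Complex.ofReal_add]
      push_cast
      rw [← Complex.ofReal_add, add_comm, hfh x hx]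
      simp
  · ext z
    obtain ⟨x, h0, h1, rfl⟩ := exists_coe_eq_unitAddCircle z
    have e1 : x + ((-1 : ℤ) : ℝ) * θ = x - θ := by push_cast; ring
    have e2 : x + ((-(M : ℤ) : ℤ) : ℝ) * θ = x - M * θ := by push_cast; ring
    simp only [ContinuousMap.mul_apply, ContinuousMap.add_apply, rotate_apply,
      ← AddCircle.coe_add, circleFunction_coe h0 h1]
    rw [e1, e2, circleFunction_coe_sub (by linarith) hg0 hθ.le h0 h1,
      circleFunction_coe_sub hMθ.le hh0 (by linarith) h0 h1]
    have := congrArg (fun r : ℝ => (r : ℂ)) (hdiag x)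
    push_cast at this
    linear_combination this
  · rw [integral_circleFunction hf0, hint]
  · have h0 : 0 ≤ x₀ := by
      by_contra h0
      exact hx₀ (hh0 x₀ (Or.inl (not_le.1 h0).le))
    have h1 : x₀ < 1 := by linarith [hh_lt x₀ hx₀]
    refine ⟨x₀, ?_, ?_⟩
    · rw [circleFunction_coe h0 h1]
      exact_mod_cast hx₀
    · rw [circleFunction_coe h0 h1, hgh0 x₀ hx₀, Complex.ofReal_zero]

theorem proposition1 (θ : ℝ) (hθ : Irrational θ) (M n : ℕ)
    (hn : 1 ≤ n) (hnM : n ≤ M * (M + 1) / 2)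
    (hθ_pos : 0 < θ) (hθ_lt : θ < 1 / ((max n M : ℕ) : ℝ)) :
    (∃ p : {p : NCTorus θ // IsStarProjection p},
      NCTorus.HasOrder p.1 M ∧
      NCTorus.trace p.1 = ((n * θ : ℝ) : ℂ) ∧
      NCTorus.IsClassOfTrace (K0.mk p) (n * θ)) ∧
    (∃ q : {q : NCTorus θ // IsStarProjection q},
      NCTorus.HasOrder q.1 M ∧
      NCTorus.trace q.1 = ((1 - n * θ : ℝ) : ℂ) ∧
      NCTorus.IsClassOfTrace (K0.mk q) (1 - n * θ)) := by
  have hM : 1 ≤ M := by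
    rcases Nat.eq_zero_or_pos M with rfl | h
    · omega
    · exact h
  have hmax : ((max n M : ℕ) : ℝ) * θ < 1 := by
    have hpos : (0 : ℝ) < ((max n M : ℕ) : ℝ) := by
      exact_mod_cast hn.trans (le_max_left n M)
    rw [lt_div_iff₀ hpos] at hθ_lt
    linarith
  have hle : ∀ k : ℕ, k ≤ max n M → k * θ < 1 := fun k hk => by
    have : (k : ℝ) ≤ ((max n M : ℕ) : ℝ) := by exact_mod_cast hk
    exact (mul_le_mul_of_nonneg_right this hθ_pos.le).trans_lt hmax
  obtain ⟨f, g, h, hp, hint, z, hz, hgz⟩ := NCTorus.exists_twoStep hn hM hθ_pos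
    (hle n (le_max_left n M)) (hle M (le_max_right n M))
  have hM0 : (M : ℤ) ≠ 0 := by omega
  -- for `M = 1` the coefficient of `U^M` is `g + h`, hence the evaluation at a zero of `g`
  rw [NCTorus.twoStep_eq_fourierSum θ hM] at hp
  obtain ⟨a, ha⟩ : ∃ a : ℤ → C(UnitAddCircle, ℂ), a = Pi.single 0 f + Pi.single 1 g +
      Pi.single (-1) (NCTorus.rotate θ (-1) (star g)) + Pi.single (M : ℤ) h +
      Pi.single (-(M : ℤ)) (NCTorus.rotate θ (-M) (star h)) := ⟨_, rfl⟩
  rw [← ha] at hp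
  have ha0 : a 0 = f := by
    simp [ha, Pi.single_eq_of_ne hM0.symm, Pi.single_eq_of_ne (neg_ne_zero.2 hM0).symm]
  have haM : a M z = h z := by
    have h1 : (M : ℤ) ≠ -1 := by omega
    have h2 : (M : ℤ) ≠ -M := by omega
    have h3 : (Pi.single 1 g : ℤ → C(UnitAddCircle, ℂ)) M z = 0 := by
      rw [Pi.single_apply]
      split_ifs
      · exact hgz
      · rfl
    simp only [ha, Pi.add_apply, ContinuousMap.add_apply, h3, Pi.single_eq_of_ne hM0,
      Pi.single_eq_of_ne h1, Pi.single_eq_of_ne h2, Pi.single_eq_same]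
    simp
  have htr : NCTorus.trace (NCTorus.fourierSum θ M a) = ((n * θ : ℝ) : ℂ) := by
    rw [NCTorus.trace_fourierSum, ha0, hint]
  have htr' : NCTorus.trace (1 - NCTorus.fourierSum θ M a) = ((1 - n * θ : ℝ) : ℂ) := by
    have h1 : NCTorus.trace (1 : NCTorus θ) = 1 := by
      simpa using NCTorus.trace_U_zpow_mul_V_zpow θ 0 0
    have h2 := NCTorus.trace_add (1 - NCTorus.fourierSum θ M a) (NCTorus.fourierSum θ M a)
    rw [sub_add_cancel, h1, htr] at h2
    push_cast at h2 ⊢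
    linear_combination -h2
  refine ⟨⟨⟨_, hp⟩, ⟨a, rfl, fun h0 => hz ?_⟩, htr, ⟨_, hp⟩, htr, rfl⟩,
    ⟨⟨_, hp.one_sub⟩, ⟨Pi.single 0 1 - a, (NCTorus.fourierSum_one_sub θ M a).symm,
      fun h0 => hz ?_⟩, htr', ⟨_, hp.one_sub⟩, htr', rfl⟩⟩
  · rw [← haM, h0]; rfl
  · rw [Pi.sub_apply, Pi.single_eq_of_ne hM0, zero_sub, neg_eq_zero] at h0
    rw [← haM, h0]; rfl
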